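/- Let $\alpha>0$ and $K=[-\alpha,\alpha]^2$. Consider $u\in C^2(K)$ of the form $u(x,y)=f(x)+g(y)$, where $f,g:[-\alpha,\alpha]\to\mathbb R$ satisfy $$f(0)=g(0)=0,\qquad f'(0)=g'(0)=0,\qquad f''(0)\,g''(0)<0,\tag{1}$$ $$f'(x)>0>g'(x)\ \text{ for } x\in(0,\alpha],\qquad f'(x)<0<g'(x)\ \text{ for } x\in[-\alpha,0).\tag{2}$$ Put $\Gamma^s=\{0\}\times[-\alpha,\alpha]$, $\Gamma^u=[-\alpha,\alpha]\times\{0\}$ and $\Gamma=\Gamma^s\cup\Gamma^u$. Define $F,G$ on $[-\alpha,\alpha]\setminus\{0\}$ by $F(x)=\int_{\alpha}^{x}\frac{dt}{f'(t)}$, $G(x)=\int_{\alpha}^{x}\frac{dt}{g'(t)}$ for $x\in(0,\alpha]$, and by the same formulas with lower limit $-\alpha$ for $x\in[-\alpha,0)$; $F^{-1},G^{-1}$ denote the inverses of $F,G$ restricted to $(0,\alpha]$ or to $[-\alpha,0)$. Let $Q$ be the set of the points $(x,y)$ in the interior of $K$ such that $$f(\pm\alpha)+g\big(G^{-1}(-F(x)+G(y))\big)>0\quad\text{and}\quad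 g(\pm\alpha)+f\big(F^{-1}(-G(y)+F(x))\big)<0,$$ where the sign in $f(\pm\alpha)$ and the branch of $F^{-1}$ are given by the sign of $x$, the sign in $g(\pm\alpha)$ and the branch of $G^{-1}$ by the sign of $y$, with the conventions $F(0)=-\infty$, $G(0)=\infty$, $F^{-1}(-\infty)=G^{-1}(\infty)=0$ (so all the points of $\Gamma$ interior to $K$ belong to $Q$). For an open set $\Omega\subset K$, $\nabla u$ is said to be isotropically realizable in $\Omega$ with the conductivity $\sigma$ if $\sigma>0$ a.e. in $\Omega$ and $\mathrm{div}(\sigma\nabla u)=0$ in the sense of distributions in $\Omega$. Then $Q$ is an open neighborhood of $(0,0)$, and for each $p\in Q\setminus\Gamma$ the solution $X(\cdot,p)$ of $\partial_tX(t,p)=\nabla u(X(t,p))$, $X(0,p)=p$, reaches the set $\{u=0\}$, while staying in the interior of $K$, at a unique time $\tau(p)\in\mathbb R$. The function $$w(p)=\int_0^{\tau(p)}\Delta u\big(X(s,p)\big)\,ds$$ belongs to $C^1(Q\setminus\Gamma)$. Moreover: (i) If $\nabla u$ is isotropically realizable in $Q$ with a conductivity $\sigma$ such that $\sigma,\sigma^{-1}\in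 L^\infty_{\rm loc}(Q)\cap C^1(Q\setminus\Gamma)$, then $\Delta u(0,0)=0$. (ii) If $\Delta u(0,0)=0$ and the functions $F-\dfrac{\ln|\cdot|}{f''(0)}$ and $G-\dfrac{\ln|\cdot|}{g''(0)}$ are bounded in a neighborhood of $0$, then $\nabla u$ is isotropically realizable in $Q$ with a conductivity $\sigma$ such that $\sigma,\sigma^{-1}\in L^\infty_{\rm loc}(Q)\cap C^1(Q\setminus\Gamma)$. (iii) For every $\alpha>0$ there exists a function $u\in C^2(K)$ of the form $u(x,y)=f(x)+g(y)$ satisfying (1), (2) and $\Delta u(0,0)=0$ such that, for any open neighborhood $V\subset K$ of $(0,0)$, $\nabla u$ is not isotropically realizable in $V$ with any conductivity $\sigma$ such that $\sigma,\sigma^{-1}\in L^\infty(V)\cap C^1(V\setminus\Gamma)$. -/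

import Mathlib

open Set Filter Topology MeasureTheory
open scoped ContDiff

noncomputable section

/-- First partial derivative of a function on the plane. -/
def partialX (u : ℝ × ℝ → ℝ) (p : ℝ × ℝ) : ℝ := deriv (fun x => u (x, p.2)) p.1

/-- Second partial derivative of a function on the plane. -/
def partialY (u : ℝ × ℝ → ℝ) (p : ℝ × ℝ) : ℝ := deriv (fun y => u (p.1, y)) p.2

/-- The gradient in the plane. -/
def planeGrad (u : ℝ × ℝ → ℝ) (p : ℝ × ℝ) : ℝ × ℝ := (partialX u p, partialY u p)

/-- The Laplacian in the plane. -/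
def planeLaplacian (u : ℝ × ℝ → ℝ) (p : ℝ × ℝ) : ℝ :=
  partialX (partialX u) p + partialY (partialY u) p

/-- `K = [-α, α]²`. -/
def squareK (α : ℝ) : Set (ℝ × ℝ) := Icc (-α) α ×ˢ Icc (-α) α

/-- The stable curve `{0} × [-α, α]`. -/
def stableCurve (α : ℝ) : Set (ℝ × ℝ) := {0} ×ˢ Icc (-α) α

/-- The unstable curve `[-α, α] × {0}`. -/
def unstableCurve (α : ℝ) : Set (ℝ × ℝ) := Icc (-α) α ×ˢ {0}

/-- The potential `u(x, y) = f(x) + g(y)`. -/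
def sepPotential (f g : ℝ → ℝ) (p : ℝ × ℝ) : ℝ := f p.1 + g p.2

/-- First derivative of a function on `[-α, α]` (one-sided at the end points). -/
def der1 (α : ℝ) (h : ℝ → ℝ) : ℝ → ℝ := derivWithin h (Icc (-α) α)

/-- Second derivative of a function on `[-α, α]` (one-sided at the end points). -/
def der2 (α : ℝ) (h : ℝ → ℝ) : ℝ → ℝ := derivWithin (der1 α h) (Icc (-α) α)

/-- `u(x, y) = f(x) + g(y)` is of class `C²` on `[-α, α]²`, and `f`, `g` satisfy the normalization,
the saddle condition at the origin and the sign conditions on `f'`, `g'`. Only the values of `f` and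
`g` on `[-α, α]` matter. -/
structure IsSaddlePair (α : ℝ) (f g : ℝ → ℝ) : Prop where
  contDiffOn : ContDiffOn ℝ 2 (sepPotential f g) (squareK α)
  f_zero : f 0 = 0
  g_zero : g 0 = 0
  f_der_zero : der1 α f 0 = 0
  g_der_zero : der1 α g 0 = 0
  saddle : der2 α f 0 * der2 α g 0 < 0
  right : ∀ x ∈ Ioc 0 α, 0 < der1 α f x ∧ der1 α g x < 0
  left : ∀ x ∈ Ico (-α) 0, der1 α f x < 0 ∧ 0 < der1 α g x

/-- The function `F` (for `h = f`) or `G` (for `h = g`) on `[-α, α] \ {0}`: the primitive of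
`1 / h'` that vanishes at `α` on `(0, α]`, and at `-α` on `[-α, 0)`. -/
def timePrimitive (α : ℝ) (h : ℝ → ℝ) (x : ℝ) : ℝ :=
  if 0 < x then ∫ t in α..x, 1 / der1 α h t else ∫ t in (-α)..x, 1 / der1 α h t

/-- The end point `α` or `-α` lying on the same side of `0` as `x`. -/
def sideEnd (α x : ℝ) : ℝ := if 0 < x then α else -α

/-- The one of the two intervals `(0, α]`, `[-α, 0)` lying on the same side of `0` as `x`. -/
def sideInterval (α x : ℝ) : Set ℝ := if 0 < x then Ioc 0 α else Ico (-α) 0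

/-- The reciprocal function of `F` (or `G`) restricted to the one of the intervals `(0, α]`,
`[-α, 0)` that contains `x`. -/
def sideInverse (α : ℝ) (h : ℝ → ℝ) (x : ℝ) : ℝ → ℝ :=
  Function.invFunOn (timePrimitive α h) (sideInterval α x)

/-- The set `Q`: the points `(x, y)` interior to `K` with
`f(±α) + g(G⁻¹(-F(x) + G(y))) > 0` and `g(±α) + f(F⁻¹(-G(y) + F(x))) < 0`, where the signs and the
branches are those of `x` for `f, F` and of `y` for `g, G`. On the axes the conventions `F(0) = -∞`,
`G(0) = ∞`, `F⁻¹(-∞) = G⁻¹(∞) = 0` reduce the two conditions to `f(±α) > 0` and `g(±α) < 0`, which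
always hold, so that all the points of the axes interior to `K` belong to `Q`. -/
def regionQ (α : ℝ) (f g : ℝ → ℝ) : Set (ℝ × ℝ) :=
  {p | p ∈ interior (squareK α) ∧
    (p.1 = 0 ∨ p.2 = 0 ∨
      (0 < f (sideEnd α p.1)
          + g (sideInverse α g p.2 (-timePrimitive α f p.1 + timePrimitive α g p.2)) ∧
        g (sideEnd α p.2)
          + f (sideInverse α f p.1 (-timePrimitive α g p.2 + timePrimitive α f p.1)) < 0))}

/-- `X` solves the gradient system `X' = ∇u(X)`, `X(0) = p`, on the time interval between `0` and
`T` (`T` may be negative), stays in `S` during that interval, and reaches `{u = 0}` at time `T`. -/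
structure IsHittingArc (u : ℝ × ℝ → ℝ) (S : Set (ℝ × ℝ)) (p : ℝ × ℝ) (T : ℝ)
    (X : ℝ → ℝ × ℝ) : Prop where
  init : X 0 = p
  mem : ∀ t ∈ uIcc 0 T, X t ∈ S
  ode : ∀ t ∈ uIcc 0 T, HasDerivWithinAt X (planeGrad u (X t)) (uIcc 0 T) t
  hit : u (X T) = 0

/-- For each point `p` of `D`, the gradient trajectory issued from `p` reaches the equipotential
`{u = 0}` inside `S`, at the unique time `τ p`, and `w p` is the integral of `Δu` along it from time
`0` to time `τ p`. -/
def IsHittingIntegral (u : ℝ × ℝ → ℝ) (S D : Set (ℝ × ℝ)) (τ w : ℝ × ℝ → ℝ) : Prop :=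
  ∀ p ∈ D, (∃ X, IsHittingArc u S p (τ p) X) ∧
    ∀ T X, IsHittingArc u S p T X →
      T = τ p ∧ w p = ∫ s in (0 : ℝ)..T, planeLaplacian u (X s)

/-- `∇u` is isotropically realizable in the open set `Ω` with the conductivity `σ`: `σ > 0` a.e. in
`Ω` and `div (σ ∇u) = 0` in the sense of distributions in `Ω`. -/
def IsRealizableWith (u : ℝ × ℝ → ℝ) (Ω : Set (ℝ × ℝ)) (σ : ℝ × ℝ → ℝ) : Prop :=
  (∀ᵐ p ∂(volume.restrict Ω), 0 < σ p) ∧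
    LocallyIntegrableOn σ Ω ∧
    ∀ φ : ℝ × ℝ → ℝ, ContDiff ℝ ∞ φ → HasCompactSupport φ → tsupport φ ⊆ Ω →
      ∫ p in Ω, σ p * (partialX u p * partialX φ p + partialY u p * partialY φ p) = 0

/-- `h ∈ L^∞(Ω)`. -/
def MemLinf (Ω : Set (ℝ × ℝ)) (h : ℝ × ℝ → ℝ) : Prop := MemLp h ⊤ (volume.restrict Ω)

/-- `h ∈ L^∞_loc(Ω)`. -/
def MemLinfLoc (Ω : Set (ℝ × ℝ)) (h : ℝ × ℝ → ℝ) : Prop :=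
  ∀ C : Set (ℝ × ℝ), IsCompact C → C ⊆ Ω → MemLinf C h

/-- `H - ln|·| / h''(0)` is bounded in a (punctured) neighborhood of `0`, where `H = F` for `h = f`
and `H = G` for `h = g`. -/
def LogBounded (α : ℝ) (h : ℝ → ℝ) : Prop :=
  ∃ C : ℝ, ∀ᶠ x in 𝓝[≠] (0 : ℝ), |timePrimitive α h x - Real.log |x| / der2 α h 0| ≤ C

end

/-!
In the coordinates `(F(x), -G(y))`, which both tend to `-∞` at the axes, the gradient flow is the
translation by `(t, -t)`. Hence `F(x) - G(y)` is a first integral,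
`X(t, p) = (F⁻¹(F(x) + t), G⁻¹(G(y) + t))`, and the inequalities defining `Q` say that `u`, which
increases along the flow, changes sign on the part of the trajectory lying in the interior of `K`.
The map `(u, F - G)` is injective on each quadrant, so by the inverse function theorem the point of
`{u = 0}` is a `C¹` function of `p`. Along the flow, `ln |f'(x) g'(y)|` has derivative `Δu`; thus
`w(p)` is its increment from `p` to the hitting point. Off the axes `σ = exp w` solves
`div (σ ∇u) = 0`. If `w` is bounded, the equation extends across the axes, because the flux `σ ∇u`
vanishes there to first order in its normal component, which compensates for the gradient of a
cutoff. When `F` and `G` are logarithmic up to bounded terms, `ln |f'|` and `ln |g'|` are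
`f''(0) F` and `g''(0) G` up to bounded terms, and the first integral makes `w` bounded if
`f''(0) + g''(0) = 0`.

Conversely, `σ f' g'` is constant along the trajectories for any conductivity `σ`. Comparing the
two ends of a trajectory close to the saddle point shows that `ln f'(F⁻¹(t)) - ln |g'(G⁻¹(-t))|` is
bounded as `t → -∞`; its derivative tends to `f''(0) + g''(0)`, which must vanish. For
`f'(x) = x (1 - 1 / ℓ(x))` with `ℓ` a logarithm and `g(y) = -y² / 2`, this difference is unbounded
although `Δu(0, 0) = 0`.
-/

noncomputable section

/-! ### Profiles and their time primitives -/

section General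

lemma mul_pos_of_mul_pos_of_mul_pos {R : Type*} [CommRing R] [LinearOrder R] [IsStrictOrderedRing R]
    {a b x : R} (ha : 0 < a * x) (hb : 0 < b * x) : 0 < a * b := by
  rcases mul_pos_iff.1 ha with ⟨h1, h2⟩ | ⟨h1, h2⟩
  · exact mul_pos h1 (pos_of_mul_pos_left hb h2.le)
  · exact mul_pos_of_neg_of_neg h1 (neg_of_mul_pos_left hb h2.le)

lemma eventually_mul_pos {x : ℝ} (hx : x ≠ 0) : ∀ᶠ t in 𝓝 x, 0 < t * x :=
  (continuous_mul_const x).continuousAt.eventually (lt_mem_nhds (mul_self_pos.2 hx))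

lemma eq_of_abs_eq_of_mul_nonneg {x y : ℝ} (hxy : 0 ≤ x * y) (h : |x| = |y|) : x = y := by
  rcases abs_eq_abs.1 h with h | h
  · exact h
  · have : y * y ≤ 0 := by rw [h] at hxy; linarith
    have hy : y = 0 := mul_self_eq_zero.1 (this.antisymm (mul_self_nonneg y))
    rw [h, hy, neg_zero]

lemma lt_iff_abs_lt_of_deriv_mul_pos {s : Set ℝ} (hs : s.OrdConnected) {φ φ' : ℝ → ℝ}
    (hc : ContinuousOn φ s) (hφ : ∀ x ∈ s, x ≠ 0 → HasDerivWithinAt φ (φ' x) s x)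
    (hpos : ∀ x ∈ s, x ≠ 0 → 0 < φ' x * x) {x y : ℝ} (hx : x ∈ s) (hy : y ∈ s) (hxy : 0 ≤ x * y) :
    φ x < φ y ↔ |x| < |y| := by
  have hmono : StrictMonoOn φ (s ∩ Ici 0) := by
    refine strictMonoOn_of_hasDerivWithinAt_pos (hs.inter ordConnected_Ici).convex
      (hc.mono inter_subset_left) (f' := φ') (fun t ht => ?_) fun t ht => ?_
    all_goals
      have hts := interior_mono inter_subset_left ht
      have ht0 : 0 < t := by simpa using interior_mono inter_subset_right ht
    · exact (hφ t (interior_subset hts) ht0.ne').mono (interior_subset.trans inter_subset_left)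
    · exact pos_of_mul_pos_left (hpos t (interior_subset hts) ht0.ne') ht0.le
  have hanti : StrictAntiOn φ (s ∩ Iic 0) := by
    refine strictAntiOn_of_hasDerivWithinAt_neg (hs.inter ordConnected_Iic).convex
      (hc.mono inter_subset_left) (f' := φ') (fun t ht => ?_) fun t ht => ?_
    all_goals
      have hts := interior_mono inter_subset_left ht
      have ht0 : t < 0 := by simpa using interior_mono inter_subset_right ht
    · exact (hφ t (interior_subset hts) ht0.ne).mono (interior_subset.trans inter_subset_left)
    · exact neg_of_mul_pos_left (hpos t (interior_subset hts) ht0.ne) ht0.le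
  rcases mul_nonneg_iff.1 hxy with ⟨hx0, hy0⟩ | ⟨hx0, hy0⟩
  · rw [hmono.lt_iff_lt ⟨hx, hx0⟩ ⟨hy, hy0⟩, abs_of_nonneg hx0, abs_of_nonneg hy0]
  · rw [hanti.lt_iff_gt ⟨hx, hx0⟩ ⟨hy, hy0⟩, abs_of_nonpos hx0, abs_of_nonpos hy0, neg_lt_neg_iff]

end General

section Sides

variable {α x y z : ℝ}

lemma sideEnd_congr (h : 0 < x * y) : sideEnd α x = sideEnd α y := by
  simp only [sideEnd, pos_iff_pos_of_mul_pos h]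

lemma sideInterval_congr (h : 0 < x * y) : sideInterval α x = sideInterval α y := by
  simp only [sideInterval, pos_iff_pos_of_mul_pos h]

lemma sideInverse_congr (h : ℝ → ℝ) (hxy : 0 < x * y) : sideInverse α h x = sideInverse α h y := by
  simp only [sideInverse, sideInterval_congr hxy]

lemma sideInterval_eq_inter (hx : x ≠ 0) : sideInterval α x = Icc (-α) α ∩ {t | 0 < t * x} := by
  ext z
  have hside : 0 < z * x ↔ (if 0 < x then 0 < z else z < 0) := by
    split_ifs with h
    · exact mul_pos_iff_of_pos_right h
    · have hx' : x < 0 := lt_of_le_of_ne (not_lt.1 h) hx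
      exact ⟨fun hz => neg_of_mul_pos_left hz hx'.le, fun hz => mul_pos_of_neg_of_neg hz hx'⟩
  change z ∈ sideInterval α x ↔ z ∈ Icc (-α) α ∧ 0 < z * x
  rw [hside, sideInterval]
  split_ifs <;> grind

lemma mem_sideInterval_iff (hx : x ≠ 0) : z ∈ sideInterval α x ↔ z ∈ Icc (-α) α ∧ 0 < z * x := by
  rw [sideInterval_eq_inter hx]
  rfl

lemma ordConnected_sideInterval (α x : ℝ) : (sideInterval α x).OrdConnected := by
  unfold sideInterval
  split_ifs
  exacts [ordConnected_Ioc, ordConnected_Ico]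

lemma measurableSet_sideInterval (α x : ℝ) : MeasurableSet (sideInterval α x) := by
  unfold sideInterval
  split_ifs
  exacts [measurableSet_Ioc, measurableSet_Ico]

lemma sideEnd_mem_sideInterval (hα : 0 < α) (x : ℝ) : sideEnd α x ∈ sideInterval α x := by
  unfold sideEnd sideInterval
  split_ifs <;> simp [hα]

lemma sideEnd_mul_pos (hα : 0 < α) (hx : x ≠ 0) : 0 < sideEnd α x * x :=
  ((mem_sideInterval_iff hx).1 (sideEnd_mem_sideInterval hα x)).2

lemma abs_sideEnd (hα : 0 < α) (x : ℝ) : |sideEnd α x| = α := by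
  unfold sideEnd
  split_ifs <;> simp [abs_of_pos hα]

lemma nhdsWithin_sideInterval_self (hx : x ≠ 0) : 𝓝[sideInterval α x] x = 𝓝[Icc (-α) α] x := by
  rw [sideInterval_eq_inter hx]
  exact nhdsWithin_inter_of_mem' (mem_nhdsWithin_of_mem_nhds (eventually_mul_pos hx))

lemma zero_mem_closure_sideInterval (hα : 0 < α) (x : ℝ) : 0 ∈ closure (sideInterval α x) := by
  unfold sideInterval
  split_ifs
  · rw [closure_Ioc hα.ne]
    exact left_mem_Icc.2 hα.le
  · rw [closure_Ico (neg_lt_zero.2 hα).ne]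
    exact right_mem_Icc.2 (neg_nonpos.2 hα.le)

lemma timePrimitive_eq_integral (α : ℝ) (h : ℝ → ℝ) (x : ℝ) :
    timePrimitive α h x = ∫ t in sideEnd α x..x, 1 / der1 α h t := by
  unfold timePrimitive sideEnd
  split_ifs <;> rfl

lemma timePrimitive_sideEnd (hα : 0 < α) (h : ℝ → ℝ) (hx : x ≠ 0) :
    timePrimitive α h (sideEnd α x) = 0 := by
  rw [timePrimitive_eq_integral, sideEnd_congr (sideEnd_mul_pos hα hx),
    intervalIntegral.integral_same]

end Sides

/-- The functions `f` and `-g` of a saddle pair: `C²` functions on `[-α, α]` vanishing to first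
order at `0`, with positive second derivative at `0` and no other critical point. -/
structure IsProfile (α : ℝ) (h : ℝ → ℝ) : Prop where
  contDiffOn : ContDiffOn ℝ 2 h (Icc (-α) α)
  zero : h 0 = 0
  der_zero : der1 α h 0 = 0
  der2_pos : 0 < der2 α h 0
  right : ∀ x ∈ Ioc 0 α, 0 < der1 α h x
  left : ∀ x ∈ Ico (-α) 0, der1 α h x < 0

namespace IsProfile

variable {α : ℝ} {h : ℝ → ℝ} {x y s t : ℝ}

lemma radius_pos (P : IsProfile α h) : 0 < α := by
  by_contra! hα
  have hsub : (Icc (-α) α).Subsingleton := subsingleton_Icc_of_ge (by linarith)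
  exact P.der2_pos.ne'
    (derivWithin_zero_of_not_accPt fun h0 => Set.Infinite.of_accPt h0 hsub.finite)

lemma zero_mem (P : IsProfile α h) : (0 : ℝ) ∈ Ioo (-α) α :=
  ⟨neg_lt_zero.2 P.radius_pos, P.radius_pos⟩

lemma sideEnd_mem (P : IsProfile α h) (x : ℝ) : sideEnd α x ∈ Icc (-α) α :=
  abs_le.1 (abs_sideEnd P.radius_pos x).le

lemma uniqueDiffOn (P : IsProfile α h) : UniqueDiffOn ℝ (Icc (-α) α) :=
  uniqueDiffOn_Icc (neg_lt_self P.radius_pos)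

lemma contDiffOn_der1 (P : IsProfile α h) : ContDiffOn ℝ 1 (der1 α h) (Icc (-α) α) :=
  P.contDiffOn.derivWithin P.uniqueDiffOn (by norm_num)

lemma continuousOn_der2 (P : IsProfile α h) : ContinuousOn (der2 α h) (Icc (-α) α) :=
  P.contDiffOn_der1.continuousOn_derivWithin P.uniqueDiffOn le_rfl

lemma hasDerivWithinAt (P : IsProfile α h) (hx : x ∈ Icc (-α) α) :
    HasDerivWithinAt h (der1 α h x) (Icc (-α) α) x :=
  (P.contDiffOn.differentiableOn (by norm_num) x hx).hasDerivWithinAt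

lemma hasDerivAt (P : IsProfile α h) (hx : x ∈ Ioo (-α) α) : HasDerivAt h (der1 α h x) x :=
  (P.hasDerivWithinAt (Ioo_subset_Icc_self hx)).hasDerivAt (Icc_mem_nhds hx.1 hx.2)

lemma hasDerivAt_der1 (P : IsProfile α h) (hx : x ∈ Ioo (-α) α) :
    HasDerivAt (der1 α h) (der2 α h x) x :=
  (P.contDiffOn_der1.differentiableOn (by norm_num) x
    (Ioo_subset_Icc_self hx)).hasDerivWithinAt.hasDerivAt (Icc_mem_nhds hx.1 hx.2)

lemma contDiffAt (P : IsProfile α h) (hx : x ∈ Ioo (-α) α) : ContDiffAt ℝ 2 h x :=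
  P.contDiffOn.contDiffAt (Icc_mem_nhds hx.1 hx.2)

lemma contDiffAt_der1 (P : IsProfile α h) (hx : x ∈ Ioo (-α) α) :
    ContDiffAt ℝ 1 (der1 α h) x :=
  P.contDiffOn_der1.contDiffAt (Icc_mem_nhds hx.1 hx.2)

lemma der1_mul_pos (P : IsProfile α h) (hx : x ∈ Icc (-α) α) (h0 : x ≠ 0) :
    0 < der1 α h x * x := by
  rcases lt_or_gt_of_ne h0 with h1 | h1
  · exact mul_pos_of_neg_of_neg (P.left x ⟨hx.1, h1⟩) h1
  · exact mul_pos (P.right x ⟨h1, hx.2⟩) h1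

lemma der1_ne_zero (P : IsProfile α h) (hx : x ∈ Icc (-α) α) (h0 : x ≠ 0) : der1 α h x ≠ 0 :=
  left_ne_zero_of_mul (P.der1_mul_pos hx h0).ne'

lemma one_div_der1_mul_pos (P : IsProfile α h) (hx : x ∈ Icc (-α) α) (h0 : x ≠ 0) :
    0 < 1 / der1 α h x * x := by
  have hne := P.der1_ne_zero hx h0
  have : 1 / der1 α h x * x = der1 α h x * x / der1 α h x ^ 2 := by field_simp
  rw [this]
  exact div_pos (P.der1_mul_pos hx h0) (by positivity)

lemma lt_iff_abs_lt (P : IsProfile α h) (hx : x ∈ Icc (-α) α) (hy : y ∈ Icc (-α) α)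
    (hxy : 0 ≤ x * y) : h x < h y ↔ |x| < |y| :=
  lt_iff_abs_lt_of_deriv_mul_pos ordConnected_Icc P.contDiffOn.continuousOn
    (fun _ ht _ => P.hasDerivWithinAt ht) (fun _ => P.der1_mul_pos) hx hy hxy

lemma pos (P : IsProfile α h) (hx : x ∈ Icc (-α) α) (h0 : x ≠ 0) : 0 < h x := by
  have := (P.lt_iff_abs_lt (Ioo_subset_Icc_self P.zero_mem) hx (by simp)).2 (by simpa using h0)
  rwa [P.zero] at this

lemma exists_der1_bounds (P : IsProfile α h) :
    ∃ m M : ℝ, 0 < m ∧ 0 < M ∧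
      ∀ x ∈ Icc (-α) α, m * |x| ≤ |der1 α h x| ∧ |der1 α h x| ≤ M * |x| := by
  have hcont : ContinuousOn (dslope (der1 α h) 0) (Icc (-α) α) :=
    (continuousOn_dslope (Icc_mem_nhds P.zero_mem.1 P.zero_mem.2)).2
      ⟨P.contDiffOn_der1.continuousOn, (P.hasDerivAt_der1 P.zero_mem).differentiableAt⟩
  have hmul : ∀ x, der1 α h x = dslope (der1 α h) 0 x * x := fun x => by
    simpa [P.der_zero, mul_comm] using (sub_smul_dslope (der1 α h) 0 x).symm
  have hpos : ∀ x ∈ Icc (-α) α, 0 < dslope (der1 α h) 0 x := by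
    intro x hx
    by_cases hx0 : x = 0
    · rw [hx0, dslope_same, (P.hasDerivAt_der1 P.zero_mem).deriv]
      exact P.der2_pos
    · have := P.der1_mul_pos hx hx0
      rw [hmul, mul_assoc] at this
      exact pos_of_mul_pos_left this (mul_self_nonneg x)
  have hne : (Icc (-α) α).Nonempty := ⟨0, Ioo_subset_Icc_self P.zero_mem⟩
  obtain ⟨a, ha, hmin⟩ := isCompact_Icc.exists_isMinOn hne hcont
  obtain ⟨b, hb, hmax⟩ := isCompact_Icc.exists_isMaxOn hne hcont
  refine ⟨_, _, hpos a ha, hpos b hb, fun x hx => ?_⟩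
  rw [hmul x, abs_mul, abs_of_pos (hpos x hx)]
  exact ⟨mul_le_mul_of_nonneg_right (hmin hx) (abs_nonneg x),
    mul_le_mul_of_nonneg_right (hmax hx) (abs_nonneg x)⟩

lemma continuousOn_one_div_der1 (P : IsProfile α h) (hx : x ≠ 0) :
    ContinuousOn (fun t => 1 / der1 α h t) (sideInterval α x) := by
  have hmem : ∀ t ∈ sideInterval α x, t ∈ Icc (-α) α ∧ 0 < t * x := fun t =>
    (mem_sideInterval_iff hx).1
  exact continuousOn_const.div (P.contDiffOn_der1.continuousOn.mono fun t ht => (hmem t ht).1)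
    fun t ht => P.der1_ne_zero (hmem t ht).1 (left_ne_zero_of_mul (hmem t ht).2.ne')

lemma hasDerivWithinAt_timePrimitive (P : IsProfile α h) (hx : x ∈ Icc (-α) α) (h0 : x ≠ 0) :
    HasDerivWithinAt (timePrimitive α h) (1 / der1 α h x) (Icc (-α) α) x := by
  have := Fact.mk hx
  have hmem : x ∈ sideInterval α x := (mem_sideInterval_iff h0).2 ⟨hx, mul_self_pos.2 h0⟩
  have hcont := P.continuousOn_one_div_der1 h0
  have hint : IntervalIntegrable (fun t => 1 / der1 α h t) volume (sideEnd α x) x :=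
    (hcont.mono ((ordConnected_sideInterval α x).uIcc_subset
      (sideEnd_mem_sideInterval P.radius_pos x) hmem)).intervalIntegrable
  have hderiv : HasDerivWithinAt (fun u => ∫ t in sideEnd α x..u, 1 / der1 α h t)
      (1 / der1 α h x) (Icc (-α) α) x := by
    refine intervalIntegral.integral_hasDerivWithinAt_right hint (t := Icc (-α) α) ?_ ?_
    · rw [← nhdsWithin_sideInterval_self h0]
      exact hcont.stronglyMeasurableAtFilter_nhdsWithin (measurableSet_sideInterval α x) x
    · rw [ContinuousWithinAt, ← nhdsWithin_sideInterval_self h0]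
      exact hcont x hmem
  refine hderiv.congr_of_eventuallyEq ?_ (timePrimitive_eq_integral α h x)
  filter_upwards [mem_nhdsWithin_of_mem_nhds (eventually_mul_pos h0)] with t ht
  rw [timePrimitive_eq_integral, sideEnd_congr ht]

lemma hasDerivAt_timePrimitive (P : IsProfile α h) (hx : x ∈ Ioo (-α) α) (h0 : x ≠ 0) :
    HasDerivAt (timePrimitive α h) (1 / der1 α h x) x :=
  (P.hasDerivWithinAt_timePrimitive (Ioo_subset_Icc_self hx) h0).hasDerivAt
    (Icc_mem_nhds hx.1 hx.2)

lemma contDiffAt_timePrimitive (P : IsProfile α h) (hx : x ∈ Ioo (-α) α) (h0 : x ≠ 0) :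
    ContDiffAt ℝ 1 (timePrimitive α h) x := by
  refine contDiffAt_one_iff.2 ⟨fun t => (1 / der1 α h t) • (1 : ℝ →L[ℝ] ℝ), Ioo (-α) α ∩ {0}ᶜ,
    (isOpen_Ioo.inter isOpen_compl_singleton).mem_nhds ⟨hx, h0⟩, ?_, fun t ht => ?_⟩
  · exact (continuousOn_const.div (P.contDiffOn_der1.continuousOn.mono
      (inter_subset_left.trans Ioo_subset_Icc_self))
      fun t ht => P.der1_ne_zero (Ioo_subset_Icc_self ht.1) ht.2).smul continuousOn_const
  · exact (P.hasDerivAt_timePrimitive ht.1 ht.2).hasFDerivAt.congr_fderiv (by ext; simp)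

lemma hasDerivWithinAt_timePrimitive_sideInterval (P : IsProfile α h) (hx : x ≠ 0)
    (ht : t ∈ sideInterval α x) :
    HasDerivWithinAt (timePrimitive α h) (1 / der1 α h t) (sideInterval α x) t := by
  rw [mem_sideInterval_iff hx] at ht
  refine (P.hasDerivWithinAt_timePrimitive ht.1 (left_ne_zero_of_mul ht.2.ne')).mono ?_
  rw [sideInterval_eq_inter hx]
  exact inter_subset_left

lemma continuousOn_timePrimitive (P : IsProfile α h) (hx : x ≠ 0) :
    ContinuousOn (timePrimitive α h) (sideInterval α x) := fun _ ht =>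
  (P.hasDerivWithinAt_timePrimitive_sideInterval hx ht).continuousWithinAt

lemma timePrimitive_lt_iff (P : IsProfile α h) (hx : x ∈ Icc (-α) α) (hy : y ∈ Icc (-α) α)
    (hxy : 0 < x * y) : timePrimitive α h x < timePrimitive α h y ↔ |x| < |y| := by
  have hx0 : x ≠ 0 := left_ne_zero_of_mul hxy.ne'
  refine lt_iff_abs_lt_of_deriv_mul_pos (ordConnected_sideInterval α x)
    (P.continuousOn_timePrimitive hx0)
    (fun t ht _ => P.hasDerivWithinAt_timePrimitive_sideInterval hx0 ht)
    (fun t ht => P.one_div_der1_mul_pos ((mem_sideInterval_iff hx0).1 ht).1)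
    ((mem_sideInterval_iff hx0).2 ⟨hx, mul_self_pos.2 hx0⟩)
    ((mem_sideInterval_iff hx0).2 ⟨hy, mul_comm x y ▸ hxy⟩) hxy.le

lemma timePrimitive_le_iff (P : IsProfile α h) (hx : x ∈ Icc (-α) α) (hy : y ∈ Icc (-α) α)
    (hxy : 0 < x * y) : timePrimitive α h x ≤ timePrimitive α h y ↔ |x| ≤ |y| := by
  rw [← not_lt, P.timePrimitive_lt_iff hy hx (mul_comm x y ▸ hxy), not_lt]

lemma eq_of_timePrimitive_eq (P : IsProfile α h) (hx : x ∈ Icc (-α) α) (hy : y ∈ Icc (-α) α)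
    (hxy : 0 < x * y) (heq : timePrimitive α h x = timePrimitive α h y) : x = y := by
  refine eq_of_abs_eq_of_mul_nonneg hxy.le (le_antisymm ?_ ?_)
  · exact (P.timePrimitive_le_iff hx hy hxy).1 heq.le
  · exact (P.timePrimitive_le_iff hy hx (mul_comm x y ▸ hxy)).1 heq.ge

lemma timePrimitive_neg_of_mem (P : IsProfile α h) (hx : x ∈ Ioo (-α) α) (h0 : x ≠ 0) :
    timePrimitive α h x < 0 := by
  rw [← timePrimitive_sideEnd P.radius_pos h h0, P.timePrimitive_lt_iff (Ioo_subset_Icc_self hx)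
    (P.sideEnd_mem x) (mul_comm _ x ▸ sideEnd_mul_pos P.radius_pos h0), abs_sideEnd P.radius_pos]
  exact abs_lt.2 hx

lemma timePrimitive_nonpos (P : IsProfile α h) (hx : x ∈ Icc (-α) α) (h0 : x ≠ 0) :
    timePrimitive α h x ≤ 0 := by
  rw [← timePrimitive_sideEnd P.radius_pos h h0, P.timePrimitive_le_iff hx
    (P.sideEnd_mem x) (mul_comm _ x ▸ sideEnd_mul_pos P.radius_pos h0), abs_sideEnd P.radius_pos]
  exact abs_le.2 hx

lemma exists_timePrimitive_le_log (P : IsProfile α h) :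
    ∃ M > 0, ∀ x ∈ Icc (-α) α, x ≠ 0 →
      timePrimitive α h x ≤ (Real.log x - Real.log α) / M := by
  obtain ⟨_, M, _, hM, hbound⟩ := P.exists_der1_bounds
  refine ⟨M + 1, by positivity, fun x hx h0 => ?_⟩
  have hmem : ∀ t ∈ sideInterval α x, t ∈ Icc (-α) α ∧ t ≠ 0 := fun t ht => by
    rw [mem_sideInterval_iff h0] at ht
    exact ⟨ht.1, left_ne_zero_of_mul ht.2.ne'⟩
  have hderiv : ∀ t ∈ sideInterval α x, HasDerivWithinAt
      (fun u => timePrimitive α h u - Real.log u / (M + 1))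
      (1 / der1 α h t - t⁻¹ / (M + 1)) (sideInterval α x) t := fun t ht =>
    (P.hasDerivWithinAt_timePrimitive_sideInterval h0 ht).sub
      ((Real.hasDerivAt_log (hmem t ht).2).hasDerivWithinAt.div_const _)
  have hpos : ∀ t ∈ sideInterval α x, t ≠ 0 → 0 < (1 / der1 α h t - t⁻¹ / (M + 1)) * t := by
    intro t ht ht0
    have hder := P.one_div_der1_mul_pos (hmem t ht).1 ht0
    have hquot : 1 / der1 α h t * t = |t| / |der1 α h t| := by
      rw [← abs_of_pos hder, abs_mul, abs_one_div, one_div_mul_eq_div]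
    have hlt : 1 / (M + 1) < |t| / |der1 α h t| := by
      rw [div_lt_div_iff₀ (by positivity) (abs_pos.2 (P.der1_ne_zero (hmem t ht).1 ht0))]
      linarith [(hbound t (hmem t ht).1).2, abs_pos.2 ht0]
    have : t⁻¹ / (M + 1) * t = 1 / (M + 1) := by field_simp
    rw [sub_mul, hquot, this]
    linarith
  have hmono := (not_congr (lt_iff_abs_lt_of_deriv_mul_pos (ordConnected_sideInterval α x)
    (fun t ht => (hderiv t ht).continuousWithinAt) (fun t ht _ => hderiv t ht) hpos
    (sideEnd_mem_sideInterval P.radius_pos x)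
    ((mem_sideInterval_iff h0).2 ⟨hx, mul_self_pos.2 h0⟩)
    (sideEnd_mul_pos P.radius_pos h0).le)).2
    (not_lt.2 ((abs_le.2 hx).trans_eq (abs_sideEnd P.radius_pos x).symm))
  rw [not_lt, timePrimitive_sideEnd P.radius_pos h h0, ← Real.log_abs (sideEnd α x),
    abs_sideEnd P.radius_pos] at hmono
  rw [sub_div]
  linarith

lemma tendsto_timePrimitive (P : IsProfile α h) :
    Tendsto (timePrimitive α h) (𝓝[≠] 0) atBot := by
  obtain ⟨M, hM, hle⟩ := P.exists_timePrimitive_le_log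
  have hlog : Tendsto (fun x : ℝ => (Real.log x - Real.log α) / M) (𝓝[≠] 0) atBot := by
    simp only [sub_eq_add_neg]
    exact (tendsto_atBot_add_const_right _ _ Real.tendsto_log_nhdsNE_zero).atBot_div_const hM
  refine tendsto_atBot_mono' _ ?_ hlog
  filter_upwards [mem_nhdsWithin_of_mem_nhds (Icc_mem_nhds P.zero_mem.1 P.zero_mem.2),
    self_mem_nhdsWithin] with x hx h0 using hle x hx h0

lemma surjOn_timePrimitive (P : IsProfile α h) (hx : x ≠ 0) :
    SurjOn (timePrimitive α h) (sideInterval α x) (Iic 0) := by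
  have := mem_closure_iff_nhdsWithin_neBot.1 (zero_mem_closure_sideInterval P.radius_pos x)
  rw [← timePrimitive_sideEnd P.radius_pos h hx]
  refine (ordConnected_sideInterval α x).isPreconnected.intermediate_value_Iic
    (l := 𝓝[sideInterval α x] 0) (sideEnd_mem_sideInterval P.radius_pos x)
    inf_le_right (P.continuousOn_timePrimitive hx)
    (P.tendsto_timePrimitive.mono_left (nhdsWithin_mono _ fun t ht => ?_))
  exact left_ne_zero_of_mul ((mem_sideInterval_iff hx).1 ht).2.ne'

section SideInverse

lemma sideInverse_mem_sideInterval (P : IsProfile α h) (hx : x ≠ 0) (hs : s ≤ 0) :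
    sideInverse α h x s ∈ sideInterval α x :=
  Function.invFunOn_mem (P.surjOn_timePrimitive hx hs)

lemma timePrimitive_sideInverse (P : IsProfile α h) (hx : x ≠ 0) (hs : s ≤ 0) :
    timePrimitive α h (sideInverse α h x s) = s :=
  Function.invFunOn_eq (P.surjOn_timePrimitive hx hs)

lemma sideInverse_mem_Icc (P : IsProfile α h) (hx : x ≠ 0) (hs : s ≤ 0) :
    sideInverse α h x s ∈ Icc (-α) α :=
  ((mem_sideInterval_iff hx).1 (P.sideInverse_mem_sideInterval hx hs)).1

lemma sideInverse_mul_pos (P : IsProfile α h) (hx : x ≠ 0) (hs : s ≤ 0) :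
    0 < sideInverse α h x s * x :=
  ((mem_sideInterval_iff hx).1 (P.sideInverse_mem_sideInterval hx hs)).2

lemma sideInverse_ne_zero (P : IsProfile α h) (hx : x ≠ 0) (hs : s ≤ 0) :
    sideInverse α h x s ≠ 0 :=
  left_ne_zero_of_mul (P.sideInverse_mul_pos hx hs).ne'

lemma sideInverse_timePrimitive (P : IsProfile α h) (hy : y ∈ Icc (-α) α) (hyx : 0 < y * x) :
    sideInverse α h x (timePrimitive α h y) = y := by
  have hx : x ≠ 0 := right_ne_zero_of_mul hyx.ne'
  have hs := P.timePrimitive_nonpos hy (left_ne_zero_of_mul hyx.ne')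
  exact P.eq_of_timePrimitive_eq (P.sideInverse_mem_Icc hx hs) hy
    (mul_pos_of_mul_pos_of_mul_pos (P.sideInverse_mul_pos hx hs) hyx)
    (P.timePrimitive_sideInverse hx hs)

lemma sideInverse_zero (P : IsProfile α h) (hx : x ≠ 0) : sideInverse α h x 0 = sideEnd α x := by
  rw [← timePrimitive_sideEnd P.radius_pos h hx,
    P.sideInverse_timePrimitive (P.sideEnd_mem x) (sideEnd_mul_pos P.radius_pos hx)]

lemma abs_sideInverse_lt_iff (P : IsProfile α h) (hx : x ≠ 0) (hs : s ≤ 0) (ht : t ≤ 0) :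
    |sideInverse α h x s| < |sideInverse α h x t| ↔ s < t := by
  rw [← P.timePrimitive_lt_iff (P.sideInverse_mem_Icc hx hs) (P.sideInverse_mem_Icc hx ht)
    (mul_pos_of_mul_pos_of_mul_pos (P.sideInverse_mul_pos hx hs) (P.sideInverse_mul_pos hx ht)),
    P.timePrimitive_sideInverse hx hs, P.timePrimitive_sideInverse hx ht]

lemma sideInverse_mem_Ioo (P : IsProfile α h) (hx : x ≠ 0) (hs : s < 0) :
    sideInverse α h x s ∈ Ioo (-α) α := by
  have hlt := (P.abs_sideInverse_lt_iff hx hs.le le_rfl).2 hs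
  rw [P.sideInverse_zero hx, abs_sideEnd P.radius_pos] at hlt
  exact abs_lt.1 hlt

lemma hasDerivAt_sideInverse (P : IsProfile α h) (hx : x ≠ 0) (hs : s < 0) :
    HasDerivAt (sideInverse α h x) (der1 α h (sideInverse α h x s)) s := by
  have hz := P.sideInverse_mem_Ioo hx hs
  have hz0 := P.sideInverse_ne_zero hx hs.le
  have hF : HasStrictDerivAt (timePrimitive α h) (1 / der1 α h (sideInverse α h x s))
      (sideInverse α h x s) :=
    (P.contDiffAt_timePrimitive hz hz0).hasStrictDerivAt' (P.hasDerivAt_timePrimitive hz hz0)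
      one_ne_zero
  have hleft : ∀ᶠ y in 𝓝 (sideInverse α h x s),
      sideInverse α h x (timePrimitive α h y) = y := by
    filter_upwards [Icc_mem_nhds hz.1 hz.2, eventually_mul_pos hz0] with y hy hyz
    exact P.sideInverse_timePrimitive hy (mul_comm x y ▸ mul_pos_of_mul_pos_of_mul_pos
      (mul_comm _ x ▸ P.sideInverse_mul_pos hx hs.le) hyz)
  have hne := one_div_ne_zero (P.der1_ne_zero (Ioo_subset_Icc_self hz) hz0)
  simpa [P.timePrimitive_sideInverse hx hs.le] using
    (hF.to_local_left_inverse hne hleft).hasDerivAt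

lemma tendsto_sideInverse (P : IsProfile α h) (hx : x ≠ 0) :
    Tendsto (sideInverse α h x) atBot (𝓝 0) := by
  refine Metric.tendsto_nhds.2 fun ε hε => ?_
  obtain ⟨e, he, heε⟩ :=
    Metric.mem_closure_iff.1 (zero_mem_closure_sideInterval P.radius_pos x) ε hε
  rw [mem_sideInterval_iff hx] at he
  have hFe := P.timePrimitive_nonpos he.1 (left_ne_zero_of_mul he.2.ne')
  filter_upwards [eventually_lt_atBot (timePrimitive α h e)] with s hs
  have hlt := (P.abs_sideInverse_lt_iff hx (hs.le.trans hFe) hFe).2 hs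
  rw [P.sideInverse_timePrimitive he.1 he.2] at hlt
  rw [dist_zero_left, Real.norm_eq_abs] at heε
  simpa using hlt.trans heε

lemma continuousOn_sideInverse (P : IsProfile α h) (hx : x ≠ 0) :
    ContinuousOn (sideInverse α h x) (Iic 0) := by
  intro s hs
  rcases (mem_Iic.1 hs).lt_or_eq with hs | rfl
  · exact (P.hasDerivAt_sideInverse hx hs).continuousAt.continuousWithinAt
  have habs : ContinuousWithinAt (fun s => |sideInverse α h x s|) (Iic 0) 0 := by
    refine StrictMonoOn.continuousWithinAt_left_of_image_mem_nhdsWithin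
      (fun s hs t ht => (P.abs_sideInverse_lt_iff hx hs ht).2) self_mem_nhdsWithin ?_
    rw [P.sideInverse_zero hx, abs_sideEnd P.radius_pos]
    refine mem_of_superset (Ioc_mem_nhdsLE P.radius_pos) fun r hr => ?_
    have hmem : sideEnd α x / α * r ∈ Icc (-α) α ∧ 0 < sideEnd α x / α * r * x := by
      refine ⟨abs_le.1 ?_, ?_⟩
      · rw [abs_mul, abs_div, abs_sideEnd P.radius_pos, abs_of_pos P.radius_pos,
          div_self P.radius_pos.ne', one_mul, abs_of_pos hr.1]
        exact hr.2
      · rw [mul_right_comm, div_mul_eq_mul_div]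
        exact mul_pos (div_pos (sideEnd_mul_pos P.radius_pos hx) P.radius_pos) hr.1
    refine ⟨timePrimitive α h (sideEnd α x / α * r),
      P.timePrimitive_nonpos hmem.1 (left_ne_zero_of_mul hmem.2.ne'), ?_⟩
    simp only [P.sideInverse_timePrimitive hmem.1 hmem.2, abs_mul, abs_div,
      abs_sideEnd P.radius_pos, abs_of_pos P.radius_pos, div_self P.radius_pos.ne', one_mul,
      abs_of_pos hr.1]
  have hsign : ∀ s ∈ Iic (0 : ℝ),
      sideInverse α h x s = SignType.sign x * |sideInverse α h x s| := by
    intro s hs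
    rcases mul_pos_iff.1 (P.sideInverse_mul_pos hx hs) with ⟨hs, hx⟩ | ⟨hs, hx⟩
    · rw [sign_pos hx, SignType.coe_one, one_mul, abs_of_pos hs]
    · rw [sign_neg hx, SignType.coe_neg_one, neg_one_mul, abs_of_neg hs, neg_neg]
  exact (continuousWithinAt_const.mul habs).congr hsign (hsign 0 self_mem_Iic)

end SideInverse

end IsProfile

/-! ### The region `Q` -/

section Axes

variable {α : ℝ} {S : Set (ℝ × ℝ)} {p : ℝ × ℝ}

lemma mem_interior_squareK : p ∈ interior (squareK α) ↔ p.1 ∈ Ioo (-α) α ∧ p.2 ∈ Ioo (-α) α := by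
  rw [squareK, interior_prod_eq, interior_Icc, mem_prod]

lemma regionQ_subset_interior (α : ℝ) (f g : ℝ → ℝ) : regionQ α f g ⊆ interior (squareK α) :=
  fun _ hp => hp.1

lemma zero_mem_regionQ (hα : 0 < α) (f g : ℝ → ℝ) : (0, 0) ∈ regionQ α f g := by
  have h0 : (0 : ℝ) ∈ Ioo (-α) α := ⟨neg_lt_zero.2 hα, hα⟩
  exact ⟨mem_interior_squareK.2 ⟨h0, h0⟩, Or.inl rfl⟩

lemma mem_diff_axes_iff (hS : S ⊆ squareK α) :
    p ∈ S \ (stableCurve α ∪ unstableCurve α) ↔ p ∈ S ∧ p.1 ≠ 0 ∧ p.2 ≠ 0 := by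
  refine and_congr_right fun hp => ?_
  have hK := mem_prod.1 (hS hp)
  simp only [stableCurve, unstableCurve, mem_union, mem_prod, mem_singleton_iff, hK.1, hK.2,
    and_true, true_and, not_or]

lemma isOpen_diff_axes (hS : S ⊆ squareK α) (hSo : IsOpen S) :
    IsOpen (S \ (stableCurve α ∪ unstableCurve α)) := by
  have : S \ (stableCurve α ∪ unstableCurve α) = S ∩ ({p | p.1 ≠ 0} ∩ {p | p.2 ≠ 0}) :=
    Set.ext fun _ => mem_diff_axes_iff hS
  rw [this]
  exact hSo.inter ((isOpen_ne_fun continuous_fst continuous_const).inter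
    (isOpen_ne_fun continuous_snd continuous_const))

end Axes

section Negation

variable (α : ℝ) (h : ℝ → ℝ)

lemma der1_neg (x : ℝ) : der1 α (fun t => -h t) x = -der1 α h x :=
  derivWithin.fun_neg

lemma der2_neg (x : ℝ) : der2 α (fun t => -h t) x = -der2 α h x := by
  unfold der2
  rw [funext (der1_neg α h), derivWithin.fun_neg]

lemma timePrimitive_neg (x : ℝ) :
    timePrimitive α (fun t => -h t) x = -timePrimitive α h x := by
  simp only [timePrimitive_eq_integral, der1_neg, one_div, inv_neg, intervalIntegral.integral_neg]

variable {α h}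

lemma IsProfile.sideInverse_neg_apply (P : IsProfile α h) {x s : ℝ} (hx : x ≠ 0) (hs : s ≤ 0) :
    sideInverse α (fun t => -h t) x (-s) = sideInverse α h x s := by
  have hex : ∃ a ∈ sideInterval α x, timePrimitive α (fun t => -h t) a = -s :=
    ⟨_, P.sideInverse_mem_sideInterval hx hs, by
      rw [timePrimitive_neg, P.timePrimitive_sideInverse hx hs]⟩
  obtain ⟨hmem, heq⟩ := Function.invFunOn_pos hex
  rw [timePrimitive_neg, neg_inj] at heq
  rw [sideInverse, ← P.sideInverse_timePrimitive ((mem_sideInterval_iff hx).1 hmem).1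
    ((mem_sideInterval_iff hx).1 hmem).2, heq]

end Negation

section Region

variable {α : ℝ} {f k : ℝ → ℝ} {p : ℝ × ℝ}

lemma mem_regionQ_neg_iff (Pf : IsProfile α f) (Pk : IsProfile α k)
    (hp : p ∈ interior (squareK α)) (h1 : p.1 ≠ 0) (h2 : p.2 ≠ 0) :
    p ∈ regionQ α f (fun t => -k t) ↔
      k (sideInverse α k p.2 (timePrimitive α f p.1 + timePrimitive α k p.2))
          < f (sideEnd α p.1) ∧
        f (sideInverse α f p.1 (timePrimitive α f p.1 + timePrimitive α k p.2))
          < k (sideEnd α p.2) := by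
  obtain ⟨hp1, hp2⟩ := mem_interior_squareK.1 hp
  have hd : timePrimitive α f p.1 + timePrimitive α k p.2 ≤ 0 :=
    add_nonpos (Pf.timePrimitive_neg_of_mem hp1 h1).le (Pk.timePrimitive_neg_of_mem hp2 h2).le
  simp only [regionQ, mem_ofPred_eq, hp, h1, h2, true_and, false_or, timePrimitive_neg, neg_neg,
    ← neg_add, Pk.sideInverse_neg_apply h2 hd, add_comm (timePrimitive α k p.2)]
  constructor <;> rintro ⟨h3, h4⟩ <;> constructor <;> linarith

lemma eventually_comp_sideInverse_lt (Pf : IsProfile α f) (Pk : IsProfile α k) :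
    ∀ᶠ s in atBot, ∀ x y : ℝ, x ≠ 0 → y ≠ 0 → k (sideInverse α k y s) < f (sideEnd α x) := by
  have key : ∀ x y : ℝ, x ≠ 0 → y ≠ 0 →
      ∀ᶠ s in atBot, k (sideInverse α k y s) < f (sideEnd α x) := by
    intro x y hx hy
    have hlim : Tendsto (fun s => k (sideInverse α k y s)) atBot (𝓝 0) := by
      have := (Pk.hasDerivAt Pk.zero_mem).continuousAt.tendsto.comp (Pk.tendsto_sideInverse hy)
      rwa [Pk.zero] at this
    exact hlim.eventually_lt_const (Pf.pos (Pf.sideEnd_mem x)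
      (left_ne_zero_of_mul (sideEnd_mul_pos Pf.radius_pos hx).ne'))
  have hsign : ∀ x : ℝ, x ≠ 0 → 0 < x * 1 ∨ 0 < x * -1 := fun x hx => by
    rcases lt_or_gt_of_ne hx with h | h
    exacts [Or.inr (by linarith), Or.inl (by linarith)]
  have hneg : (-1 : ℝ) ≠ 0 := by norm_num
  filter_upwards [key 1 1 one_ne_zero one_ne_zero, key 1 (-1) one_ne_zero hneg,
    key (-1) 1 hneg one_ne_zero, key (-1) (-1) hneg hneg] with s h1 h2 h3 h4 x y hx hy
  rcases hsign x hx with hx | hx <;> rcases hsign y hy with hy | hy <;>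
    rwa [sideEnd_congr hx, sideInverse_congr k hy]

lemma regionQ_mem_nhds_of_mem_axes (Pf : IsProfile α f) (Pk : IsProfile α k)
    (hp : p ∈ interior (squareK α)) (haxis : p.1 = 0 ∨ p.2 = 0) :
    regionQ α f (fun t => -k t) ∈ 𝓝 p := by
  obtain ⟨s₀, hs₀⟩ := eventually_atBot.1
    ((eventually_comp_sideInverse_lt Pf Pk).and (eventually_comp_sideInverse_lt Pk Pf))
  have hfar : ∀ {h : ℝ → ℝ} {x : ℝ}, IsProfile α h → x = 0 →
      ∀ᶠ t in 𝓝 x, t ≠ 0 → timePrimitive α h t ≤ s₀ := by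
    rintro h _ P rfl
    exact eventually_nhdsWithin_iff.1 (P.tendsto_timePrimitive.eventually_le_atBot s₀)
  have hsum : ∀ᶠ q in 𝓝 p, q.1 ∈ Ioo (-α) α → q.2 ∈ Ioo (-α) α → q.1 ≠ 0 → q.2 ≠ 0 →
      timePrimitive α f q.1 + timePrimitive α k q.2 ≤ s₀ := by
    rcases haxis with h0 | h0
    · filter_upwards [continuousAt_fst.eventually (hfar Pf h0)] with q hq _ h2 h3 h4
      linarith [hq h3, Pk.timePrimitive_neg_of_mem h2 h4]
    · filter_upwards [continuousAt_snd.eventually (hfar Pk h0)] with q hq h1 _ h3 h4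
      linarith [hq h4, Pf.timePrimitive_neg_of_mem h1 h3]
  filter_upwards [hsum, isOpen_interior.mem_nhds hp] with q hq hqK
  by_cases h1 : q.1 = 0
  · exact ⟨hqK, Or.inl h1⟩
  by_cases h2 : q.2 = 0
  · exact ⟨hqK, Or.inr (Or.inl h2)⟩
  obtain ⟨hlt, hlt'⟩ := hs₀ _
    (hq (mem_interior_squareK.1 hqK).1 (mem_interior_squareK.1 hqK).2 h1 h2)
  exact (mem_regionQ_neg_iff Pf Pk hqK h1 h2).2 ⟨hlt _ _ h1 h2, hlt' _ _ h2 h1⟩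

lemma regionQ_mem_nhds_of_notMem_axes (Pf : IsProfile α f) (Pk : IsProfile α k)
    (hp : p ∈ regionQ α f (fun t => -k t)) (h1 : p.1 ≠ 0) (h2 : p.2 ≠ 0) :
    regionQ α f (fun t => -k t) ∈ 𝓝 p := by
  obtain ⟨hp1, hp2⟩ := mem_interior_squareK.1 hp.1
  obtain ⟨hlt, hlt'⟩ := (mem_regionQ_neg_iff Pf Pk hp.1 h1 h2).1 hp
  have hd := add_neg (Pf.timePrimitive_neg_of_mem hp1 h1) (Pk.timePrimitive_neg_of_mem hp2 h2)
  have hsum : ContinuousAt (fun q : ℝ × ℝ => timePrimitive α f q.1 + timePrimitive α k q.2) p :=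
    ((Pf.hasDerivAt_timePrimitive hp1 h1).continuousAt.comp continuousAt_fst).add
      ((Pk.hasDerivAt_timePrimitive hp2 h2).continuousAt.comp continuousAt_snd)
  have hcomp : ∀ {h : ℝ → ℝ} {x : ℝ}, IsProfile α h → x ≠ 0 → ContinuousAt
      (fun q : ℝ × ℝ => h (sideInverse α h x (timePrimitive α f q.1 + timePrimitive α k q.2)))
      p := fun P hx =>
    ((P.hasDerivAt (P.sideInverse_mem_Ioo hx hd)).continuousAt.comp
      (P.hasDerivAt_sideInverse hx hd).continuousAt).comp_of_eq hsum rfl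
  filter_upwards [isOpen_interior.mem_nhds hp.1,
    continuousAt_fst.eventually (eventually_mul_pos h1),
    continuousAt_snd.eventually (eventually_mul_pos h2),
    (hcomp Pk h2).eventually (gt_mem_nhds hlt), (hcomp Pf h1).eventually (gt_mem_nhds hlt')]
    with q hqK hq1 hq2 hqlt hqlt'
  rw [mem_regionQ_neg_iff Pf Pk hqK (left_ne_zero_of_mul hq1.ne') (left_ne_zero_of_mul hq2.ne'),
    sideEnd_congr hq1, sideEnd_congr hq2, sideInverse_congr f hq1, sideInverse_congr k hq2]
  exact ⟨hqlt, hqlt'⟩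

lemma isOpen_regionQ (Pf : IsProfile α f) (Pk : IsProfile α k) :
    IsOpen (regionQ α f (fun t => -k t)) := by
  refine isOpen_iff_mem_nhds.2 fun p hp => ?_
  by_cases haxis : p.1 = 0 ∨ p.2 = 0
  · exact regionQ_mem_nhds_of_mem_axes Pf Pk hp.1 haxis
  · exact regionQ_mem_nhds_of_notMem_axes Pf Pk hp (not_or.1 haxis).1 (not_or.1 haxis).2

end Region

section Flow

variable {x v : ℝ → ℝ} {a b : ℝ}

lemma eq_zero_of_abs_deriv_le_mul_abs {L : ℝ}
    (hx : ∀ t ∈ uIcc a b, HasDerivWithinAt x (v t) (uIcc a b) t)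
    (hv : ∀ t ∈ uIcc a b, |v t| ≤ L * |x t|) (ha : x a = 0) : x b = 0 := by
  have hmaps : MapsTo (AffineMap.lineMap a b) (Icc (0 : ℝ) 1) (uIcc a b) := fun s hs => by
    rw [← segment_eq_uIcc, segment_eq_image_lineMap]
    exact mem_image_of_mem _ hs
  have hderiv : ∀ s ∈ Icc (0 : ℝ) 1, HasDerivWithinAt (x ∘ AffineMap.lineMap a b)
      (v (AffineMap.lineMap a b s) * (b - a)) (Icc 0 1) s := fun s hs =>
    (hx _ (hmaps hs)).comp s AffineMap.hasDerivWithinAt_lineMap hmaps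
  have hzero := eq_zero_of_abs_deriv_le_mul_abs_self_of_eq_zero_right (K := L * |b - a|)
    (fun s hs => (hderiv s hs).continuousWithinAt)
    (fun s hs => (hderiv s (Ico_subset_Icc_self hs)).mono_of_mem_nhdsWithin
      (Icc_mem_nhdsGE_of_mem hs))
    (by simpa using ha)
    (fun s hs => by
      rw [Real.norm_eq_abs, abs_mul, Real.norm_eq_abs, mul_right_comm]
      exact mul_le_mul_of_nonneg_right (hv _ (hmaps (Ico_subset_Icc_self hs))) (abs_nonneg _))
    1 (right_mem_Icc.2 zero_le_one)
  simpa using hzero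

lemma mul_pos_of_abs_deriv_le_mul_abs {L : ℝ}
    (hx : ∀ t ∈ uIcc a b, HasDerivWithinAt x (v t) (uIcc a b) t)
    (hv : ∀ t ∈ uIcc a b, |v t| ≤ L * |x t|) (ha : x a ≠ 0) {t : ℝ} (ht : t ∈ uIcc a b) :
    0 < x t * x a := by
  have hne : ∀ s ∈ uIcc a b, x s ≠ 0 := fun s hs h0 => by
    have hsub : uIcc s a ⊆ uIcc a b := uIcc_subset_uIcc hs left_mem_uIcc
    exact ha (eq_zero_of_abs_deriv_le_mul_abs (fun r hr => (hx r (hsub hr)).mono hsub)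
      (fun r hr => hv r (hsub hr)) h0)
  by_contra! hcon
  obtain ⟨s, hs, h0⟩ := isPreconnected_uIcc.intermediate_value ht left_mem_uIcc
    (f := fun s => x s * x a) (fun s hs => (hx s hs).continuousWithinAt.mul_const _)
    ⟨hcon, mul_self_nonneg (x a)⟩
  exact mul_ne_zero (hne s hs) ha h0

namespace IsProfile

variable {α : ℝ} {h : ℝ → ℝ} {c T t : ℝ}

lemma flow_mul_pos (P : IsProfile α h) (hmem : ∀ t ∈ uIcc 0 T, x t ∈ Ioo (-α) α)
    (hx : ∀ t ∈ uIcc 0 T, HasDerivWithinAt x (c * der1 α h (x t)) (uIcc 0 T) t) (h0 : x 0 ≠ 0)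
    (ht : t ∈ uIcc 0 T) : 0 < x t * x 0 := by
  obtain ⟨_, M, _, _, hbound⟩ := P.exists_der1_bounds
  refine mul_pos_of_abs_deriv_le_mul_abs (L := |c| * M) hx (fun t ht => ?_) h0 ht
  rw [abs_mul, mul_assoc]
  exact mul_le_mul_of_nonneg_left (hbound _ (Ioo_subset_Icc_self (hmem t ht))).2 (abs_nonneg c)

lemma timePrimitive_flow (P : IsProfile α h) (hmem : ∀ t ∈ uIcc 0 T, x t ∈ Ioo (-α) α)
    (hx : ∀ t ∈ uIcc 0 T, HasDerivWithinAt x (c * der1 α h (x t)) (uIcc 0 T) t) (h0 : x 0 ≠ 0)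
    (ht : t ∈ uIcc 0 T) : timePrimitive α h (x t) = timePrimitive α h (x 0) + c * t := by
  have hderiv : ∀ s ∈ uIcc 0 T,
      HasDerivWithinAt (fun s => timePrimitive α h (x s) - c * s) 0 (uIcc 0 T) s := by
    intro s hs
    have hne : x s ≠ 0 := left_ne_zero_of_mul (P.flow_mul_pos hmem hx h0 hs).ne'
    have hder := P.der1_ne_zero (Ioo_subset_Icc_self (hmem s hs)) hne
    refine (((P.hasDerivAt_timePrimitive (hmem s hs) hne).comp_hasDerivWithinAt s (hx s hs)).sub
      ((hasDerivAt_id s).const_mul c).hasDerivWithinAt).congr_deriv ?_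
    field_simp
    ring
  have hconst := (convex_uIcc 0 T).norm_image_sub_le_of_norm_hasDerivWithin_le (C := 0) hderiv
    (fun _ _ => by simp) left_mem_uIcc ht
  simp only [zero_mul, norm_le_zero_iff, mul_zero, sub_zero] at hconst
  linarith

lemma integral_der2_flow (P : IsProfile α h) (hmem : ∀ t ∈ uIcc 0 T, x t ∈ Ioo (-α) α)
    (hx : ∀ t ∈ uIcc 0 T, HasDerivWithinAt x (c * der1 α h (x t)) (uIcc 0 T) t) (h0 : x 0 ≠ 0) :
    IntervalIntegrable (fun s => c * der2 α h (x s)) volume 0 T ∧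
    ∫ s in (0 : ℝ)..T, c * der2 α h (x s)
      = Real.log (der1 α h (x T)) - Real.log (der1 α h (x 0)) := by
  have hderiv : ∀ s ∈ uIcc 0 T, HasDerivWithinAt (fun s => Real.log (der1 α h (x s)))
      (c * der2 α h (x s)) (uIcc 0 T) s := by
    intro s hs
    have hne := P.der1_ne_zero (Ioo_subset_Icc_self (hmem s hs))
      (left_ne_zero_of_mul (P.flow_mul_pos hmem hx h0 hs).ne')
    refine (((P.hasDerivAt_der1 (hmem s hs)).comp_hasDerivWithinAt s (hx s hs)).log
      hne).congr_deriv ?_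
    simp only [Function.comp]
    field_simp
  have hint : IntervalIntegrable (fun s => c * der2 α h (x s)) volume 0 T :=
    (continuousOn_const.mul (P.continuousOn_der2.comp (fun t ht => (hx t ht).continuousWithinAt)
      fun t ht => Ioo_subset_Icc_self (hmem t ht))).intervalIntegrable
  exact ⟨hint, intervalIntegral.integral_eq_sub_of_hasDeriv_right
    (fun s hs => (hderiv s hs).continuousWithinAt)
    (fun s hs => ((hderiv s (Ioo_subset_Icc_self hs)).hasDerivAt
      (Icc_mem_nhds hs.1 hs.2)).hasDerivWithinAt) hint⟩

end IsProfile

end Flow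

/-! ### The hitting point -/

lemma contDiffAt_of_comp_eventuallyEq {E F G : Type*} [NormedAddCommGroup E] [NormedSpace ℝ E]
    [CompleteSpace E] [NormedAddCommGroup F] [NormedSpace ℝ F] [NormedAddCommGroup G]
    [NormedSpace ℝ G] {n : ℕ∞ω} {f : E → F} {f' : E ≃L[ℝ] F} {e : G → E} {c : G → F} {p : G}
    {s : Set E} (hf : ContDiffAt ℝ n f (e p)) (hf' : HasFDerivAt f (f' : E →L[ℝ] F) (e p))
    (hn : n ≠ 0) (hc : ContDiffAt ℝ n c p) (hs : s ∈ 𝓝 (e p)) (hinj : InjOn f s)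
    (he : ∀ᶠ q in 𝓝 p, e q ∈ s ∧ f (e q) = c q) : ContDiffAt ℝ n e p := by
  have hp : f (e p) = c p := he.self_of_nhds.2
  have hst := hf.hasStrictFDerivAt' hf' hn
  have hinv : ContDiffAt ℝ n (fun q => hf.localInverse hf' hn (c q)) p :=
    ContDiffAt.comp p (hp ▸ hf.to_localInverse hf' hn) hc
  have hlim : Tendsto c (𝓝 p) (𝓝 (f (e p))) := hp ▸ hc.continuousAt
  refine hinv.congr_of_eventuallyEq ?_
  filter_upwards [hlim.eventually hst.eventually_right_inverse,
    hlim.eventually (hst.localInverse_tendsto hs), he] with q hright hmem heq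
  exact hinj heq.1 hmem (heq.2.trans hright.symm)

section Hit

variable {α : ℝ} {f k : ℝ → ℝ} {p z z' : ℝ × ℝ}

/-- The part of the interior of `K` on the same side of both axes as `p`. -/
def openQuadrant (α : ℝ) (p : ℝ × ℝ) : Set (ℝ × ℝ) :=
  {z | z ∈ interior (squareK α) ∧ 0 < z.1 * p.1 ∧ 0 < z.2 * p.2}

/-- The potential `f(x) - k(y)` and the first integral `F(x) - G(y)` of its gradient flow: they are
coordinates on each open quadrant. -/
def saddleCoord (α : ℝ) (f k : ℝ → ℝ) (z : ℝ × ℝ) : ℝ × ℝ :=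
  (f z.1 - k z.2, timePrimitive α f z.1 + timePrimitive α k z.2)

/-- `z` is the point of `{u = 0}` on the trajectory through `p`. As `F(x) - G(y)` is constant along
trajectories, this is expressed without referring to the flow. -/
structure IsHitPoint (α : ℝ) (f k : ℝ → ℝ) (p z : ℝ × ℝ) : Prop where
  mem : z ∈ openQuadrant α p
  coord : saddleCoord α f k z = (0, (saddleCoord α f k p).2)

/-- The point of `{u = 0}` on the trajectory through `p`; arbitrary if there is none. -/
def hitPoint (α : ℝ) (f k : ℝ → ℝ) (p : ℝ × ℝ) : ℝ × ℝ := Classical.epsilon (IsHitPoint α f k p)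

/-- `log (f' k')` at the hitting point, which is a first integral of the flow. -/
def hitLog (α : ℝ) (f k : ℝ → ℝ) (p : ℝ × ℝ) : ℝ :=
  Real.log (der1 α f (hitPoint α f k p).1) + Real.log (der1 α k (hitPoint α f k p).2)

/-- The function `w`: the integral of the Laplacian along the trajectory through `p` up to
`{u = 0}`. -/
def hitWeight (α : ℝ) (f k : ℝ → ℝ) (p : ℝ × ℝ) : ℝ :=
  hitLog α f k p - (Real.log (der1 α f p.1) + Real.log (der1 α k p.2))

/-- The function `τ`: the time at which the trajectory through `p` meets `{u = 0}`. -/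
def hitTime (α : ℝ) (f k : ℝ → ℝ) (p : ℝ × ℝ) : ℝ :=
  timePrimitive α f (hitPoint α f k p).1 - timePrimitive α f p.1

lemma openQuadrant_mem_nhds (hz : z ∈ openQuadrant α p) : openQuadrant α p ∈ 𝓝 z :=
  (isOpen_interior.inter ((isOpen_lt continuous_const (continuous_fst.mul continuous_const)).inter
    (isOpen_lt continuous_const (continuous_snd.mul continuous_const)))).mem_nhds hz

lemma fst_mem_of_mem_openQuadrant (hz : z ∈ openQuadrant α p) : z.1 ∈ Ioo (-α) α :=
  (mem_interior_squareK.1 hz.1).1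

lemma snd_mem_of_mem_openQuadrant (hz : z ∈ openQuadrant α p) : z.2 ∈ Ioo (-α) α :=
  (mem_interior_squareK.1 hz.1).2

lemma fst_ne_zero_of_mem_openQuadrant (hz : z ∈ openQuadrant α p) : z.1 ≠ 0 :=
  left_ne_zero_of_mul hz.2.1.ne'

lemma snd_ne_zero_of_mem_openQuadrant (hz : z ∈ openQuadrant α p) : z.2 ≠ 0 :=
  left_ne_zero_of_mul hz.2.2.ne'

lemma self_mem_openQuadrant (hp : p ∈ interior (squareK α)) (h1 : p.1 ≠ 0) (h2 : p.2 ≠ 0) :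
    p ∈ openQuadrant α p :=
  ⟨hp, mul_self_pos.2 h1, mul_self_pos.2 h2⟩

lemma openQuadrant_congr (hz : z ∈ openQuadrant α p) : openQuadrant α z = openQuadrant α p := by
  have hcongr : ∀ {a b c : ℝ}, 0 < a * b → (0 < c * a ↔ 0 < c * b) := fun {a b _} hab =>
    ⟨fun h => mul_pos_of_mul_pos_of_mul_pos h (mul_comm a b ▸ hab),
      fun h => mul_pos_of_mul_pos_of_mul_pos h hab⟩
  ext y
  exact and_congr_right fun _ => and_congr (hcongr hz.2.1) (hcongr hz.2.2)

lemma injOn_saddleCoord (Pf : IsProfile α f) (Pk : IsProfile α k) (p : ℝ × ℝ) :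
    InjOn (saddleCoord α f k) (openQuadrant α p) := by
  have hle : ∀ z ∈ openQuadrant α p, ∀ z' ∈ openQuadrant α p,
      saddleCoord α f k z = saddleCoord α f k z' → |z.1| ≤ |z'.1| := by
    intro z hz z' hz' heq
    obtain ⟨hu, hd⟩ := Prod.ext_iff.1 heq
    simp only [saddleCoord] at hu hd
    have hz1 := Ioo_subset_Icc_self (fst_mem_of_mem_openQuadrant hz)
    have hz2 := Ioo_subset_Icc_self (snd_mem_of_mem_openQuadrant hz)
    have hz1' := Ioo_subset_Icc_self (fst_mem_of_mem_openQuadrant hz')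
    have hz2' := Ioo_subset_Icc_self (snd_mem_of_mem_openQuadrant hz')
    have h1 := mul_pos_of_mul_pos_of_mul_pos hz'.2.1 hz.2.1
    have h2 := mul_pos_of_mul_pos_of_mul_pos hz'.2.2 hz.2.2
    by_contra! hlt
    have hf := (Pf.lt_iff_abs_lt hz1' hz1 h1.le).2 hlt
    have hF := (Pf.timePrimitive_lt_iff hz1' hz1 h1).2 hlt
    have hK := (Pk.timePrimitive_lt_iff hz2' hz2 h2).2
      ((Pk.lt_iff_abs_lt hz2' hz2 h2.le).1 (by linarith))
    linarith
  intro z hz z' hz' heq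
  have hfst : z.1 = z'.1 := eq_of_abs_eq_of_mul_nonneg
    (mul_pos_of_mul_pos_of_mul_pos hz.2.1 hz'.2.1).le
    ((hle z hz z' hz' heq).antisymm (hle z' hz' z hz heq.symm))
  have hd := (Prod.ext_iff.1 heq).2
  simp only [saddleCoord, hfst, add_right_inj] at hd
  exact Prod.ext hfst (Pk.eq_of_timePrimitive_eq
    (Ioo_subset_Icc_self (snd_mem_of_mem_openQuadrant hz))
    (Ioo_subset_Icc_self (snd_mem_of_mem_openQuadrant hz'))
    (mul_pos_of_mul_pos_of_mul_pos hz.2.2 hz'.2.2) hd)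

lemma contDiffAt_saddleCoord (Pf : IsProfile α f) (Pk : IsProfile α k) (hz : z ∈ openQuadrant α p) :
    ContDiffAt ℝ 1 (saddleCoord α f k) z := by
  have hz1 := fst_mem_of_mem_openQuadrant hz
  have hz2 := snd_mem_of_mem_openQuadrant hz
  refine ContDiffAt.prodMk (ContDiffAt.sub ?_ ?_) (ContDiffAt.add ?_ ?_)
  · exact ((Pf.contDiffAt hz1).of_le one_le_two).comp z contDiffAt_fst
  · exact ((Pk.contDiffAt hz2).of_le one_le_two).comp z contDiffAt_snd
  · exact (Pf.contDiffAt_timePrimitive hz1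
      (fst_ne_zero_of_mem_openQuadrant hz)).comp z contDiffAt_fst
  · exact (Pk.contDiffAt_timePrimitive hz2
      (snd_ne_zero_of_mem_openQuadrant hz)).comp z contDiffAt_snd

lemma exists_hasFDerivAt_saddleCoord (Pf : IsProfile α f) (Pk : IsProfile α k)
    (hz : z ∈ openQuadrant α p) :
    ∃ e : (ℝ × ℝ) ≃L[ℝ] (ℝ × ℝ),
      HasFDerivAt (saddleCoord α f k) (e : (ℝ × ℝ) →L[ℝ] (ℝ × ℝ)) z := by
  have hz1 := fst_mem_of_mem_openQuadrant hz
  have hz2 := snd_mem_of_mem_openQuadrant hz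
  have ha := Pf.der1_ne_zero (Ioo_subset_Icc_self hz1) (fst_ne_zero_of_mem_openQuadrant hz)
  have hb := Pk.der1_ne_zero (Ioo_subset_Icc_self hz2) (snd_ne_zero_of_mem_openQuadrant hz)
  have hfst : HasFDerivAt Prod.fst (ContinuousLinearMap.fst ℝ ℝ ℝ) z := hasFDerivAt_fst
  have hsnd : HasFDerivAt Prod.snd (ContinuousLinearMap.snd ℝ ℝ ℝ) z := hasFDerivAt_snd
  have hF := Pf.hasDerivAt_timePrimitive hz1 (fst_ne_zero_of_mem_openQuadrant hz)
  have hK := Pk.hasDerivAt_timePrimitive hz2 (snd_ne_zero_of_mem_openQuadrant hz)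
  have hD := (((Pf.hasDerivAt hz1).comp_hasFDerivAt z hfst).sub
    ((Pk.hasDerivAt hz2).comp_hasFDerivAt z hsnd)).prodMk
    ((hF.comp_hasFDerivAt z hfst).add (hK.comp_hasFDerivAt z hsnd))
  clear hF hK
  generalize der1 α f z.1 = a at ha hD
  generalize der1 α k z.2 = b at hb hD
  have hinj : Function.Injective ((a • ContinuousLinearMap.fst ℝ ℝ ℝ
      - b • ContinuousLinearMap.snd ℝ ℝ ℝ).prod ((1 / a) • ContinuousLinearMap.fst ℝ ℝ ℝ
      + (1 / b) • ContinuousLinearMap.snd ℝ ℝ ℝ)).toLinearMap := by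
    refine (injective_iff_map_eq_zero _).2 fun v hv => ?_
    obtain ⟨h1, h2⟩ : a * v.1 - b * v.2 = 0 ∧ a⁻¹ * v.1 + b⁻¹ * v.2 = 0 := by
      simpa [Prod.ext_iff] using hv
    have hv2 : (a ^ 2 + b ^ 2) * v.2 = 0 := by
      field_simp at h2
      linear_combination a * h2 - b * h1
    have hv2 : v.2 = 0 := (mul_eq_zero.1 hv2).resolve_left (by positivity)
    refine Prod.ext ?_ hv2
    simpa [hv2, ha] using h1
  exact ⟨(LinearEquiv.ofInjectiveEndo _ hinj).toContinuousLinearEquiv,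
    hD.congr_fderiv (by ext <;> simp)⟩

lemma exists_isHitPoint (Pf : IsProfile α f) (Pk : IsProfile α k)
    (hp : p ∈ regionQ α f (fun t => -k t)) (h1 : p.1 ≠ 0) (h2 : p.2 ≠ 0) :
    ∃ z, IsHitPoint α f k p z := by
  obtain ⟨hp1, hp2⟩ := mem_interior_squareK.1 hp.1
  obtain ⟨hlt, hlt'⟩ := (mem_regionQ_neg_iff Pf Pk hp.1 h1 h2).1 hp
  set d := timePrimitive α f p.1 + timePrimitive α k p.2
  have hd0 : d < 0 :=
    add_neg (Pf.timePrimitive_neg_of_mem hp1 h1) (Pk.timePrimitive_neg_of_mem hp2 h2)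
  have hcomp : ∀ {h : ℝ → ℝ} {x : ℝ}, IsProfile α h → x ≠ 0 →
      ContinuousOn (fun s => h (sideInverse α h x s)) (Iic 0) := fun P hx =>
    P.contDiffOn.continuousOn.comp (P.continuousOn_sideInverse hx)
      fun s hs => P.sideInverse_mem_Icc hx hs
  have hcont : ContinuousOn (fun s => f (sideInverse α f p.1 s) - k (sideInverse α k p.2 (d - s)))
      (Icc d 0) :=
    ((hcomp Pf h1).mono Icc_subset_Iic_self).sub
      ((hcomp Pk h2).comp (by fun_prop) fun s hs => sub_nonpos.2 hs.1)
  have hzero : (0 : ℝ) ∈ Ioo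
      (f (sideInverse α f p.1 d) - k (sideInverse α k p.2 (d - d)))
      (f (sideInverse α f p.1 0) - k (sideInverse α k p.2 (d - 0))) := by
    rw [sub_self, sub_zero, Pf.sideInverse_zero h1, Pk.sideInverse_zero h2]
    exact ⟨sub_neg.2 hlt', sub_pos.2 hlt⟩
  obtain ⟨s, hs, hus⟩ := intermediate_value_Ioo hd0.le hcont hzero
  have hs' : d - s < 0 := sub_neg.2 hs.1
  refine ⟨(sideInverse α f p.1 s, sideInverse α k p.2 (d - s)),
    ⟨mem_interior_squareK.2 ⟨Pf.sideInverse_mem_Ioo h1 hs.2, Pk.sideInverse_mem_Ioo h2 hs'⟩,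
      Pf.sideInverse_mul_pos h1 hs.2.le, Pk.sideInverse_mul_pos h2 hs'.le⟩, Prod.ext hus ?_⟩
  simp only [saddleCoord, Pf.timePrimitive_sideInverse h1 hs.2.le,
    Pk.timePrimitive_sideInverse h2 hs'.le]
  linarith

namespace IsHitPoint

lemma eq (Pf : IsProfile α f) (Pk : IsProfile α k) (h : IsHitPoint α f k p z)
    (h' : IsHitPoint α f k p z') : z = z' :=
  injOn_saddleCoord Pf Pk p h.mem h'.mem (h.coord.trans h'.coord.symm)

lemma hitPoint_eq (Pf : IsProfile α f) (Pk : IsProfile α k) (h : IsHitPoint α f k p z) :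
    hitPoint α f k p = z :=
  eq Pf Pk (Classical.epsilon_spec ⟨z, h⟩) h

lemma potential_eq_zero (h : IsHitPoint α f k p z) : f z.1 = k z.2 :=
  sub_eq_zero.1 (Prod.ext_iff.1 h.coord).1

lemma time_eq (h : IsHitPoint α f k p z) :
    timePrimitive α f z.1 + timePrimitive α k z.2
      = timePrimitive α f p.1 + timePrimitive α k p.2 :=
  (Prod.ext_iff.1 h.coord).2

end IsHitPoint

lemma isHitPoint_hitPoint (Pf : IsProfile α f) (Pk : IsProfile α k)
    (hp : p ∈ regionQ α f (fun t => -k t)) (h1 : p.1 ≠ 0) (h2 : p.2 ≠ 0) :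
    IsHitPoint α f k p (hitPoint α f k p) :=
  Classical.epsilon_spec (exists_isHitPoint Pf Pk hp h1 h2)

lemma contDiffAt_hitPoint (Pf : IsProfile α f) (Pk : IsProfile α k)
    (hp : p ∈ regionQ α f (fun t => -k t)) (h1 : p.1 ≠ 0) (h2 : p.2 ≠ 0) :
    ContDiffAt ℝ 1 (hitPoint α f k) p := by
  have hz := (isHitPoint_hitPoint Pf Pk hp h1 h2).mem
  have hself := self_mem_openQuadrant hp.1 h1 h2
  obtain ⟨e, he⟩ := exists_hasFDerivAt_saddleCoord Pf Pk hz
  refine contDiffAt_of_comp_eventuallyEq (contDiffAt_saddleCoord Pf Pk hz) he one_ne_zero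
    (c := fun q => (0, (saddleCoord α f k q).2))
    (contDiffAt_const.prodMk (contDiffAt_saddleCoord Pf Pk hself).snd)
    (openQuadrant_mem_nhds hz) (injOn_saddleCoord Pf Pk p) ?_
  filter_upwards [(isOpen_regionQ Pf Pk).mem_nhds hp, openQuadrant_mem_nhds hself] with q hq hqp
  have hqz := isHitPoint_hitPoint Pf Pk hq (fst_ne_zero_of_mem_openQuadrant hqp)
    (snd_ne_zero_of_mem_openQuadrant hqp)
  exact ⟨openQuadrant_congr hqp ▸ hqz.mem, hqz.coord⟩

lemma contDiffAt_log_der1_fst_add_log_der1_snd (Pf : IsProfile α f) (Pk : IsProfile α k)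
    (hz : z ∈ openQuadrant α p) :
    ContDiffAt ℝ 1 (fun q : ℝ × ℝ => Real.log (der1 α f q.1) + Real.log (der1 α k q.2)) z := by
  have hz1 := fst_mem_of_mem_openQuadrant hz
  have hz2 := snd_mem_of_mem_openQuadrant hz
  refine ContDiffAt.add ?_ ?_
  · exact ((Pf.contDiffAt_der1 hz1).comp z contDiffAt_fst).log
      (Pf.der1_ne_zero (Ioo_subset_Icc_self hz1) (fst_ne_zero_of_mem_openQuadrant hz))
  · exact ((Pk.contDiffAt_der1 hz2).comp z contDiffAt_snd).log
      (Pk.der1_ne_zero (Ioo_subset_Icc_self hz2) (snd_ne_zero_of_mem_openQuadrant hz))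

lemma contDiffAt_hitLog (Pf : IsProfile α f) (Pk : IsProfile α k)
    (hp : p ∈ regionQ α f (fun t => -k t)) (h1 : p.1 ≠ 0) (h2 : p.2 ≠ 0) :
    ContDiffAt ℝ 1 (hitLog α f k) p :=
  (contDiffAt_log_der1_fst_add_log_der1_snd Pf Pk (isHitPoint_hitPoint Pf Pk hp h1 h2).mem).comp p
    (contDiffAt_hitPoint Pf Pk hp h1 h2)

lemma contDiffAt_hitWeight (Pf : IsProfile α f) (Pk : IsProfile α k)
    (hp : p ∈ regionQ α f (fun t => -k t)) (h1 : p.1 ≠ 0) (h2 : p.2 ≠ 0) :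
    ContDiffAt ℝ 1 (hitWeight α f k) p :=
  (contDiffAt_hitLog Pf Pk hp h1 h2).sub
    (contDiffAt_log_der1_fst_add_log_der1_snd Pf Pk (self_mem_openQuadrant hp.1 h1 h2))

end Hit

/-! ### The gradient flow -/

section Flow

variable {α : ℝ} {f k : ℝ → ℝ} {p : ℝ × ℝ} {t : ℝ}

/-- The solution `X(t, p)` of the gradient system of `f(x) - k(y)` for `p` off the axes. It is in
the interior of `K` for `K(p.2) < t < -F(p.1)`. -/
def saddleFlow (α : ℝ) (f k : ℝ → ℝ) (p : ℝ × ℝ) (t : ℝ) : ℝ × ℝ :=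
  (sideInverse α f p.1 (timePrimitive α f p.1 + t),
    sideInverse α k p.2 (timePrimitive α k p.2 - t))

lemma saddleFlow_zero (Pf : IsProfile α f) (Pk : IsProfile α k) (hp : p ∈ openQuadrant α p) :
    saddleFlow α f k p 0 = p := by
  rw [saddleFlow, add_zero, sub_zero,
    Pf.sideInverse_timePrimitive (Ioo_subset_Icc_self (fst_mem_of_mem_openQuadrant hp)) hp.2.1,
    Pk.sideInverse_timePrimitive (Ioo_subset_Icc_self (snd_mem_of_mem_openQuadrant hp)) hp.2.2]

lemma zero_mem_Ioo_timePrimitive (Pf : IsProfile α f) (Pk : IsProfile α k)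
    (hp : p ∈ openQuadrant α p) : 0 ∈ Ioo (timePrimitive α k p.2) (-timePrimitive α f p.1) :=
  ⟨Pk.timePrimitive_neg_of_mem (snd_mem_of_mem_openQuadrant hp)
    (snd_ne_zero_of_mem_openQuadrant hp),
    neg_pos.2 (Pf.timePrimitive_neg_of_mem (fst_mem_of_mem_openQuadrant hp)
      (fst_ne_zero_of_mem_openQuadrant hp))⟩

lemma saddleFlow_mem_openQuadrant (Pf : IsProfile α f) (Pk : IsProfile α k) (h1 : p.1 ≠ 0)
    (h2 : p.2 ≠ 0) (ht : t ∈ Ioo (timePrimitive α k p.2) (-timePrimitive α f p.1)) :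
    saddleFlow α f k p t ∈ openQuadrant α p := by
  have hF : timePrimitive α f p.1 + t < 0 := by linarith [ht.2]
  have hK : timePrimitive α k p.2 - t < 0 := sub_neg.2 ht.1
  exact ⟨mem_interior_squareK.2 ⟨Pf.sideInverse_mem_Ioo h1 hF, Pk.sideInverse_mem_Ioo h2 hK⟩,
    Pf.sideInverse_mul_pos h1 hF.le, Pk.sideInverse_mul_pos h2 hK.le⟩

lemma saddleCoord_saddleFlow_snd (Pf : IsProfile α f) (Pk : IsProfile α k) (h1 : p.1 ≠ 0)
    (h2 : p.2 ≠ 0) (ht : t ∈ Ioo (timePrimitive α k p.2) (-timePrimitive α f p.1)) :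
    (saddleCoord α f k (saddleFlow α f k p t)).2 = (saddleCoord α f k p).2 := by
  simp only [saddleCoord, saddleFlow]
  rw [Pf.timePrimitive_sideInverse h1 (by linarith [ht.2]),
    Pk.timePrimitive_sideInverse h2 (by linarith [ht.1])]
  ring

lemma hasDerivAt_saddleFlow (Pf : IsProfile α f) (Pk : IsProfile α k) (h1 : p.1 ≠ 0)
    (h2 : p.2 ≠ 0) (ht : t ∈ Ioo (timePrimitive α k p.2) (-timePrimitive α f p.1)) :
    HasDerivAt (saddleFlow α f k p) (der1 α f (saddleFlow α f k p t).1,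
      -der1 α k (saddleFlow α f k p t).2) t := by
  refine HasDerivAt.prodMk ?_ ?_
  · exact (Pf.hasDerivAt_sideInverse h1 (by linarith [ht.2])).comp_const_add _ _
  · exact (Pk.hasDerivAt_sideInverse h2 (by linarith [ht.1])).comp_const_sub _ _

lemma hitPoint_saddleFlow (Pf : IsProfile α f) (Pk : IsProfile α k) (h1 : p.1 ≠ 0)
    (h2 : p.2 ≠ 0) (ht : t ∈ Ioo (timePrimitive α k p.2) (-timePrimitive α f p.1)) :
    hitPoint α f k (saddleFlow α f k p t) = hitPoint α f k p := by
  have hcoord := saddleCoord_saddleFlow_snd Pf Pk h1 h2 ht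
  have hquad := openQuadrant_congr (saddleFlow_mem_openQuadrant Pf Pk h1 h2 ht)
  have hiff : IsHitPoint α f k (saddleFlow α f k p t) = IsHitPoint α f k p := by
    ext z
    exact ⟨fun h => ⟨hquad ▸ h.mem, hcoord ▸ h.coord⟩, fun h => ⟨hquad ▸ h.mem, hcoord ▸ h.coord⟩⟩
  rw [hitPoint, hiff, hitPoint]

lemma IsHitPoint.mem_Ioo {z : ℝ × ℝ} (Pf : IsProfile α f) (Pk : IsProfile α k)
    (hz : IsHitPoint α f k p z) : timePrimitive α f z.1 - timePrimitive α f p.1 ∈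
      Ioo (timePrimitive α k p.2) (-timePrimitive α f p.1) := by
  have hF := Pf.timePrimitive_neg_of_mem (fst_mem_of_mem_openQuadrant hz.mem)
    (fst_ne_zero_of_mem_openQuadrant hz.mem)
  have hK := Pk.timePrimitive_neg_of_mem (snd_mem_of_mem_openQuadrant hz.mem)
    (snd_ne_zero_of_mem_openQuadrant hz.mem)
  constructor <;> linarith [hz.time_eq]

lemma IsHitPoint.saddleFlow_eq {z : ℝ × ℝ} (Pf : IsProfile α f) (Pk : IsProfile α k)
    (hz : IsHitPoint α f k p z) :
    saddleFlow α f k p (timePrimitive α f z.1 - timePrimitive α f p.1) = z := by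
  have hK : timePrimitive α k p.2 - (timePrimitive α f z.1 - timePrimitive α f p.1)
      = timePrimitive α k z.2 := by linarith [hz.time_eq]
  rw [saddleFlow, hK, add_sub_cancel,
    Pf.sideInverse_timePrimitive (Ioo_subset_Icc_self (fst_mem_of_mem_openQuadrant hz.mem))
      hz.mem.2.1,
    Pk.sideInverse_timePrimitive (Ioo_subset_Icc_self (snd_mem_of_mem_openQuadrant hz.mem))
      hz.mem.2.2]

lemma fderiv_hitLog (Pf : IsProfile α f) (Pk : IsProfile α k)
    (hp : p ∈ regionQ α f (fun t => -k t)) (h1 : p.1 ≠ 0) (h2 : p.2 ≠ 0) :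
    fderiv ℝ (hitLog α f k) p (der1 α f p.1, -der1 α k p.2) = 0 := by
  have hself := self_mem_openQuadrant hp.1 h1 h2
  have hzero := zero_mem_Ioo_timePrimitive Pf Pk hself
  have hflow0 := saddleFlow_zero Pf Pk hself
  have hflow := hasDerivAt_saddleFlow Pf Pk h1 h2 hzero
  rw [hflow0] at hflow
  have hlog := ((contDiffAt_hitLog Pf Pk hp h1 h2).differentiableAt one_ne_zero).hasFDerivAt
  refine (hlog.comp_hasDerivAt_of_eq 0 hflow hflow0.symm).unique
    ((hasDerivAt_const _ (hitLog α f k p)).congr_of_eventuallyEq ?_)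
  filter_upwards [Ioo_mem_nhds hzero.1 hzero.2] with t ht
  simp only [Function.comp, hitLog, hitPoint_saddleFlow Pf Pk h1 h2 ht]

lemma fderiv_hitWeight (Pf : IsProfile α f) (Pk : IsProfile α k)
    (hp : p ∈ regionQ α f (fun t => -k t)) (h1 : p.1 ≠ 0) (h2 : p.2 ≠ 0) :
    fderiv ℝ (hitWeight α f k) p (der1 α f p.1, -der1 α k p.2)
      = der2 α k p.2 - der2 α f p.1 := by
  obtain ⟨hp1, hp2⟩ := mem_interior_squareK.1 hp.1
  have hlog := ((contDiffAt_hitLog Pf Pk hp h1 h2).differentiableAt one_ne_zero).hasFDerivAt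
  have hf0 := Pf.der1_ne_zero (Ioo_subset_Icc_self hp1) h1
  have hk0 := Pk.der1_ne_zero (Ioo_subset_Icc_self hp2) h2
  have hf := ((Pf.hasDerivAt_der1 hp1).log hf0).comp_hasFDerivAt p
    (hasFDerivAt_fst (𝕜 := ℝ) (E := ℝ) (F := ℝ))
  have hk := ((Pk.hasDerivAt_der1 hp2).log hk0).comp_hasFDerivAt p
    (hasFDerivAt_snd (𝕜 := ℝ) (E := ℝ) (F := ℝ))
  have hw : HasFDerivAt (hitWeight α f k) _ p := hlog.sub (hf.add hk)
  rw [hw.fderiv]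
  simp only [sub_apply, add_apply, smul_apply, ContinuousLinearMap.coe_fst',
    ContinuousLinearMap.coe_snd', fderiv_hitLog Pf Pk hp h1 h2, smul_eq_mul]
  field_simp
  ring

end Flow

section Potential

variable {α : ℝ} {f k : ℝ → ℝ} {p : ℝ × ℝ}

lemma partialX_sepPotential (Pf : IsProfile α f) (g : ℝ → ℝ) (hp : p.1 ∈ Ioo (-α) α) :
    partialX (sepPotential f g) p = der1 α f p.1 :=
  ((Pf.hasDerivAt hp).add_const (g p.2)).deriv

lemma partialY_sepPotential (Pk : IsProfile α k) (f : ℝ → ℝ) (hp : p.2 ∈ Ioo (-α) α) :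
    partialY (sepPotential f (fun t => -k t)) p = -der1 α k p.2 :=
  ((Pk.hasDerivAt hp).neg.const_add (f p.1)).deriv

lemma planeGrad_sepPotential (Pf : IsProfile α f) (Pk : IsProfile α k)
    (hp : p ∈ interior (squareK α)) :
    planeGrad (sepPotential f (fun t => -k t)) p = (der1 α f p.1, -der1 α k p.2) := by
  rw [mem_interior_squareK] at hp
  rw [planeGrad, partialX_sepPotential Pf _ hp.1, partialY_sepPotential Pk _ hp.2]

lemma planeLaplacian_sepPotential (Pf : IsProfile α f) (Pk : IsProfile α k)
    (hp : p ∈ interior (squareK α)) :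
    planeLaplacian (sepPotential f (fun t => -k t)) p = der2 α f p.1 - der2 α k p.2 := by
  rw [mem_interior_squareK] at hp
  have hX : partialX (partialX (sepPotential f (fun t => -k t))) p = der2 α f p.1 := by
    refine ((Pf.hasDerivAt_der1 hp.1).congr_of_eventuallyEq ?_).deriv
    filter_upwards [Ioo_mem_nhds hp.1.1 hp.1.2] with t ht
    exact partialX_sepPotential Pf _ (p := (t, p.2)) ht
  have hY : partialY (partialY (sepPotential f (fun t => -k t))) p = -der2 α k p.2 := by
    refine ((Pk.hasDerivAt_der1 hp.2).neg.congr_of_eventuallyEq ?_).deriv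
    filter_upwards [Ioo_mem_nhds hp.2.1 hp.2.2] with t ht
    exact partialY_sepPotential Pk _ (p := (p.1, t)) ht
  rw [planeLaplacian, hX, hY, sub_eq_add_neg]

lemma isHittingArc_saddleFlow (Pf : IsProfile α f) (Pk : IsProfile α k)
    (hp : p ∈ openQuadrant α p) (hz : IsHitPoint α f k p (hitPoint α f k p)) :
    IsHittingArc (sepPotential f (fun t => -k t)) (interior (squareK α)) p (hitTime α f k p)
      (saddleFlow α f k p) := by
  have h1 := fst_ne_zero_of_mem_openQuadrant hp
  have h2 := snd_ne_zero_of_mem_openQuadrant hp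
  have hmem : ∀ t ∈ uIcc 0 (hitTime α f k p),
      t ∈ Ioo (timePrimitive α k p.2) (-timePrimitive α f p.1) := fun t ht =>
    ordConnected_Ioo.uIcc_subset (zero_mem_Ioo_timePrimitive Pf Pk hp) (hz.mem_Ioo Pf Pk) ht
  have hK : ∀ t ∈ uIcc 0 (hitTime α f k p), saddleFlow α f k p t ∈ interior (squareK α) :=
    fun t ht => (saddleFlow_mem_openQuadrant Pf Pk h1 h2 (hmem t ht)).1
  refine ⟨saddleFlow_zero Pf Pk hp, hK, fun t ht => ?_, ?_⟩
  · rw [planeGrad_sepPotential Pf Pk (hK t ht)]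
    exact (hasDerivAt_saddleFlow Pf Pk h1 h2 (hmem t ht)).hasDerivWithinAt
  · rw [hitTime, hz.saddleFlow_eq Pf Pk, sepPotential, hz.potential_eq_zero, add_neg_cancel]

end Potential

namespace IsHittingArc

variable {α : ℝ} {f k : ℝ → ℝ} {p : ℝ × ℝ} {T t : ℝ} {X : ℝ → ℝ × ℝ}

lemma hasDerivWithinAt_fst (Pf : IsProfile α f) (Pk : IsProfile α k)
    (hX : IsHittingArc (sepPotential f (fun t => -k t)) (interior (squareK α)) p T X)
    (ht : t ∈ uIcc 0 T) :
    HasDerivWithinAt (fun s => (X s).1) (1 * der1 α f (X t).1) (uIcc 0 T) t := by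
  have := (hX.ode t ht).fst
  rwa [planeGrad_sepPotential Pf Pk (hX.mem t ht), ← one_mul (der1 α f _)] at this

lemma hasDerivWithinAt_snd (Pf : IsProfile α f) (Pk : IsProfile α k)
    (hX : IsHittingArc (sepPotential f (fun t => -k t)) (interior (squareK α)) p T X)
    (ht : t ∈ uIcc 0 T) :
    HasDerivWithinAt (fun s => (X s).2) (-1 * der1 α k (X t).2) (uIcc 0 T) t := by
  have := (hX.ode t ht).snd
  rwa [planeGrad_sepPotential Pf Pk (hX.mem t ht), ← neg_one_mul] at this

lemma time_eq_and_integral_eq (Pf : IsProfile α f) (Pk : IsProfile α k)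
    (hX : IsHittingArc (sepPotential f (fun t => -k t)) (interior (squareK α)) p T X)
    (h1 : p.1 ≠ 0) (h2 : p.2 ≠ 0) :
    T = hitTime α f k p ∧ hitWeight α f k p =
      ∫ s in (0 : ℝ)..T, planeLaplacian (sepPotential f (fun t => -k t)) (X s) := by
  have hmem1 := fun t ht => (mem_interior_squareK.1 (hX.mem t ht)).1
  have hmem2 := fun t ht => (mem_interior_squareK.1 (hX.mem t ht)).2
  have hx := fun t => hX.hasDerivWithinAt_fst Pf Pk (t := t)
  have hy := fun t => hX.hasDerivWithinAt_snd Pf Pk (t := t)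
  rw [← hX.init] at h1 h2
  have hF := Pf.timePrimitive_flow hmem1 hx h1 right_mem_uIcc
  have hK := Pk.timePrimitive_flow hmem2 hy h2 right_mem_uIcc
  have hsx := Pf.flow_mul_pos hmem1 hx h1 right_mem_uIcc
  have hsy := Pk.flow_mul_pos hmem2 hy h2 right_mem_uIcc
  obtain ⟨hintx, hix⟩ := Pf.integral_der2_flow hmem1 hx h1
  obtain ⟨hinty, hiy⟩ := Pk.integral_der2_flow hmem2 hy h2
  rw [hX.init] at hF hK hsx hsy hix hiy
  have hz : IsHitPoint α f k p (X T) :=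
    ⟨⟨hX.mem T right_mem_uIcc, hsx, hsy⟩, Prod.ext hX.hit (by
      simp only [saddleCoord, hF, hK]; ring)⟩
  constructor
  · rw [hitTime, hz.hitPoint_eq Pf Pk, hF]
    ring
  · have hΔ : ∀ s ∈ uIcc 0 T, planeLaplacian (sepPotential f (fun t => -k t)) (X s)
        = 1 * der2 α f (X s).1 + -1 * der2 α k (X s).2 := fun s hs => by
      rw [planeLaplacian_sepPotential Pf Pk (hX.mem s hs)]
      ring
    rw [intervalIntegral.integral_congr hΔ, intervalIntegral.integral_add hintx hinty, hix, hiy,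
      hitWeight, hitLog, hz.hitPoint_eq Pf Pk]
    ring

end IsHittingArc

lemma isHittingIntegral_hitTime {α : ℝ} {f k : ℝ → ℝ} (Pf : IsProfile α f) (Pk : IsProfile α k) :
    IsHittingIntegral (sepPotential f (fun t => -k t)) (interior (squareK α))
      (regionQ α f (fun t => -k t) \ (stableCurve α ∪ unstableCurve α))
      (hitTime α f k) (hitWeight α f k) := by
  intro p hp
  rw [mem_diff_axes_iff ((regionQ_subset_interior α _ _).trans interior_subset)] at hp
  obtain ⟨hpQ, h1, h2⟩ := hp
  exact ⟨⟨_, isHittingArc_saddleFlow Pf Pk (self_mem_openQuadrant hpQ.1 h1 h2)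
    (isHitPoint_hitPoint Pf Pk hpQ h1 h2)⟩, fun _ _ hX => hX.time_eq_and_integral_eq Pf Pk h1 h2⟩

/-! ### Divergence and cutoff functions -/

section IntegrationByParts

lemma integrable_mul_of_tsupport_subset {X : Type*} [TopologicalSpace X] [MeasurableSpace X]
    [OpensMeasurableSpace X] {μ : Measure X} [IsFiniteMeasureOnCompacts μ] {U : Set X}
    {a b : X → ℝ} (hU : IsOpen U)
    (ha : ContinuousOn a U) (hb : Continuous b) (hc : HasCompactSupport b) (hs : tsupport b ⊆ U) :
    Integrable (fun p => a p * b p) μ :=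
  ((ha.mul hb.continuousOn).continuous_of_tsupport_subset hU
    (tsupport_mul_subset_right.trans hs)).integrable_of_hasCompactSupport hc.mul_left

variable {V : Type*} [NormedAddCommGroup V] [NormedSpace ℝ V] [MeasurableSpace V] [BorelSpace V]
  {μ : Measure V} {U : Set V} {a φ : V → ℝ}

lemma integrable_mul_fderiv_of_tsupport_subset [IsFiniteMeasureOnCompacts μ] (hU : IsOpen U)
    (ha : ContinuousOn a U) (hφ : ContDiff ℝ 1 φ) (hc : HasCompactSupport φ) (hs : tsupport φ ⊆ U)
    (v : V) : Integrable (fun p => a p * fderiv ℝ φ p v) μ :=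
  integrable_mul_of_tsupport_subset hU ha
    ((hφ.continuous_fderiv one_ne_zero).clm_apply continuous_const) (hc.fderiv_apply ℝ v)
    ((tsupport_fderiv_apply_subset ℝ v).trans hs)

lemma integrable_fderiv_mul_of_tsupport_subset [IsFiniteMeasureOnCompacts μ] (hU : IsOpen U)
    (ha : ContDiffOn ℝ 1 a U) (hφ : Continuous φ) (hc : HasCompactSupport φ) (hs : tsupport φ ⊆ U)
    (v : V) : Integrable (fun p => fderiv ℝ a p v * φ p) μ :=
  integrable_mul_of_tsupport_subset hU
    ((ha.continuousOn_fderiv_of_isOpen hU le_rfl).clm_apply continuousOn_const) hφ hc hs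

lemma integral_mul_fderiv_eq_neg_of_tsupport_subset [FiniteDimensional ℝ V] [μ.IsAddHaarMeasure]
    (hU : IsOpen U) (ha : ContDiffOn ℝ 1 a U) (hφ : ContDiff ℝ 1 φ) (hc : HasCompactSupport φ)
    (hs : tsupport φ ⊆ U) (v : V) :
    ∫ p, a p * fderiv ℝ φ p v ∂μ = -∫ p, fderiv ℝ a p v * φ p ∂μ :=
  integral_mul_fderiv_eq_neg_fderiv_mul_of_integrable
    (integrable_fderiv_mul_of_tsupport_subset hU ha hφ.continuous hc hs v)
    (integrable_mul_fderiv_of_tsupport_subset hU ha.continuousOn hφ hc hs v)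
    (integrable_mul_of_tsupport_subset hU ha.continuousOn hφ.continuous hc hs)
    (fun _ hp => (ha.contDiffAt (hU.mem_nhds (hs hp))).differentiableAt one_ne_zero)
    (fun _ _ => hφ.differentiable one_ne_zero _)

end IntegrationByParts

section Divergence

variable {E : ℝ × ℝ → ℝ × ℝ} {φ σ u : ℝ × ℝ → ℝ} {U Ω : Set (ℝ × ℝ)} {p : ℝ × ℝ}

/-- The divergence of a vector field on the plane. -/
def planeDiv (E : ℝ × ℝ → ℝ × ℝ) (p : ℝ × ℝ) : ℝ :=
  (fderiv ℝ E p (1, 0)).1 + (fderiv ℝ E p (0, 1)).2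

lemma apply_eq_mul_add_mul (L : ℝ × ℝ →L[ℝ] ℝ) (v : ℝ × ℝ) :
    L v = v.1 * L (1, 0) + v.2 * L (0, 1) := by
  rw [← smul_eq_mul, ← smul_eq_mul, ← map_smul, ← map_smul, ← map_add]
  simp

lemma planeDiv_smul (hσ : DifferentiableAt ℝ σ p) (hE : DifferentiableAt ℝ E p) :
    planeDiv (fun q => σ q • E q) p = fderiv ℝ σ p (E p) + σ p * planeDiv E p := by
  rw [planeDiv, planeDiv, fderiv_fun_smul hσ hE, apply_eq_mul_add_mul (fderiv ℝ σ p)]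
  simp only [add_apply, smul_apply, ContinuousLinearMap.smulRight_apply, Prod.fst_add, Prod.snd_add,
    Prod.smul_fst, Prod.smul_snd, smul_eq_mul]
  ring

lemma partialX_eq_fderiv (hφ : DifferentiableAt ℝ φ p) : partialX φ p = fderiv ℝ φ p (1, 0) :=
  (hφ.hasFDerivAt.comp_hasDerivAt (f := fun x => (x, p.2)) p.1
    ((hasDerivAt_id p.1).prodMk (hasDerivAt_const p.1 p.2))).deriv

lemma partialY_eq_fderiv (hφ : DifferentiableAt ℝ φ p) : partialY φ p = fderiv ℝ φ p (0, 1) :=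
  (hφ.hasFDerivAt.comp_hasDerivAt (f := fun y => (p.1, y)) p.2
    ((hasDerivAt_const p.2 p.1).prodMk (hasDerivAt_id p.2))).deriv

lemma fderiv_apply_smul_planeGrad (hφ : DifferentiableAt ℝ φ p) (c : ℝ) (u : ℝ × ℝ → ℝ) :
    fderiv ℝ φ p (c • planeGrad u p)
      = c * (partialX u p * partialX φ p + partialY u p * partialY φ p) := by
  rw [map_smul, smul_eq_mul, apply_eq_mul_add_mul, ← partialX_eq_fderiv hφ,
    ← partialY_eq_fderiv hφ, planeGrad]

lemma planeDiv_planeGrad (hu : DifferentiableAt ℝ (planeGrad u) p) :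
    planeDiv (planeGrad u) p = planeLaplacian u p := by
  have hX : DifferentiableAt ℝ (partialX u) p := hu.fst
  have hY : DifferentiableAt ℝ (partialY u) p := hu.snd
  rw [planeDiv, planeLaplacian, partialX_eq_fderiv hX, partialY_eq_fderiv hY]
  exact congrArg₂ (· + ·) (congrArg (· (1, 0)) (fderiv.fst hu).symm)
    (congrArg (· (0, 1)) (fderiv.snd hu).symm)

lemma continuousOn_planeDiv (hU : IsOpen U) (hE : ContDiffOn ℝ 1 E U) :
    ContinuousOn (planeDiv E) U := by
  have h := hE.continuousOn_fderiv_of_isOpen hU le_rfl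
  exact (h.clm_apply continuousOn_const).fst.add (h.clm_apply continuousOn_const).snd

lemma integral_fderiv_apply_eq_neg_integral_mul_planeDiv (hU : IsOpen U) (hE : ContDiffOn ℝ 1 E U)
    (hφ : ContDiff ℝ 1 φ) (hc : HasCompactSupport φ) (hs : tsupport φ ⊆ U) :
    ∫ p, fderiv ℝ φ p (E p) = -∫ p, φ p * planeDiv E p := by
  have hE1 : ContDiffOn ℝ 1 (fun p => (E p).1) U := hE.fst
  have hE2 : ContDiffOn ℝ 1 (fun p => (E p).2) U := hE.snd
  have hdiv : ∀ p, φ p * planeDiv E p = fderiv ℝ (fun q => (E q).1) p (1, 0) * φ p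
      + fderiv ℝ (fun q => (E q).2) p (0, 1) * φ p := by
    intro p
    by_cases hp : p ∈ U
    · have hd := (hE.contDiffAt (hU.mem_nhds hp)).differentiableAt one_ne_zero
      rw [planeDiv, fderiv.fst hd, fderiv.snd hd]
      simp only [ContinuousLinearMap.comp_apply, ContinuousLinearMap.coe_fst',
        ContinuousLinearMap.coe_snd']
      ring
    · simp only [image_eq_zero_of_notMem_tsupport (fun h => hp (hs h)), zero_mul, mul_zero,
        add_zero]
  simp only [hdiv, apply_eq_mul_add_mul (fderiv ℝ φ _) (E _)]
  rw [integral_add (integrable_mul_fderiv_of_tsupport_subset hU hE1.continuousOn hφ hc hs _)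
      (integrable_mul_fderiv_of_tsupport_subset hU hE2.continuousOn hφ hc hs _),
    integral_add (integrable_fderiv_mul_of_tsupport_subset hU hE1 hφ.continuous hc hs _)
      (integrable_fderiv_mul_of_tsupport_subset hU hE2 hφ.continuous hc hs _),
    integral_mul_fderiv_eq_neg_of_tsupport_subset hU hE1 hφ hc hs,
    integral_mul_fderiv_eq_neg_of_tsupport_subset hU hE2 hφ hc hs, neg_add]

lemma setIntegral_fderiv_apply_eq_neg_integral_mul_planeDiv (hU : IsOpen U) (hUΩ : U ⊆ Ω)
    (hE : ContDiffOn ℝ 1 E U) (hφ : ContDiff ℝ 1 φ) (hc : HasCompactSupport φ)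
    (hs : tsupport φ ⊆ U) : ∫ p in Ω, fderiv ℝ φ p (E p) = -∫ p, φ p * planeDiv E p := by
  rw [← integral_fderiv_apply_eq_neg_integral_mul_planeDiv hU hE hφ hc hs]
  refine setIntegral_eq_integral_of_forall_compl_eq_zero fun p hp => ?_
  rw [fderiv_of_notMem_tsupport ℝ fun h => hp (hUΩ (hs h)), zero_apply]

lemma setIntegral_fderiv_apply_eq_zero_of_planeDiv_eq_zero (hU : IsOpen U) (hUΩ : U ⊆ Ω)
    (hE : ContDiffOn ℝ 1 E U) (hdiv : ∀ p ∈ U, planeDiv E p = 0) (hφ : ContDiff ℝ 1 φ)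
    (hc : HasCompactSupport φ) (hs : tsupport φ ⊆ U) : ∫ p in Ω, fderiv ℝ φ p (E p) = 0 := by
  rw [setIntegral_fderiv_apply_eq_neg_integral_mul_planeDiv hU hUΩ hE hφ hc hs, neg_eq_zero]
  refine integral_eq_zero_of_ae (Eventually.of_forall fun p => ?_)
  by_cases hp : p ∈ tsupport φ
  · simp only [hdiv p (hs hp), mul_zero, Pi.zero_apply]
  · simp only [image_eq_zero_of_notMem_tsupport hp, zero_mul, Pi.zero_apply]

lemma planeDiv_eq_zero_of_integral_eq_zero (hU : IsOpen U) (hUΩ : U ⊆ Ω) (hE : ContDiffOn ℝ 1 E U)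
    (hweak : ∀ φ : ℝ × ℝ → ℝ, ContDiff ℝ ∞ φ → HasCompactSupport φ → tsupport φ ⊆ U →
      ∫ p in Ω, fderiv ℝ φ p (E p) = 0) (hp : p ∈ U) : planeDiv E p = 0 := by
  have hcont := continuousOn_planeDiv hU hE
  have hae : ∀ᵐ q, q ∈ U → planeDiv E q = 0 := by
    refine hU.ae_eq_zero_of_integral_contDiff_smul_eq_zero
      (hcont.locallyIntegrableOn hU.measurableSet) fun φ hφ hc hs => ?_
    simpa only [smul_eq_mul, setIntegral_fderiv_apply_eq_neg_integral_mul_planeDiv hU hUΩ hE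
      (hφ.of_le (mod_cast le_top)) hc hs, neg_eq_zero] using hweak φ hφ hc hs
  exact Measure.eqOn_open_of_ae_eq ((ae_restrict_iff' hU.measurableSet).2 hae) hU hcont
    continuousOn_const hp

end Divergence

section Cutoff

lemma integral_fderiv_apply_eq_zero_of_cutoff {V : Type*} [NormedAddCommGroup V] [NormedSpace ℝ V]
    [SecondCountableTopology V] [MeasurableSpace V] [BorelSpace V] {μ : Measure V}
    [IsFiniteMeasure μ] {E : V → V} {φ : V → ℝ} {χ : ℕ → V → ℝ} {C : ℝ} (hE : Integrable E μ)
    (hφ : ContDiff ℝ 1 φ) (hc : HasCompactSupport φ) (hχ : ∀ n, ContDiff ℝ 1 (χ n))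
    (hχ1 : ∀ n p, |χ n p| ≤ 1) (hχE : ∀ᵐ p ∂μ, ∀ n, |fderiv ℝ (χ n) p (E p)| ≤ C)
    (hlim : ∀ᵐ p ∂μ, ∀ᶠ n in atTop, χ n =ᶠ[𝓝 p] 1)
    (hzero : ∀ n, ∫ p, fderiv ℝ (fun q => φ q * χ n q) p (E p) ∂μ = 0) :
    ∫ p, fderiv ℝ φ p (E p) ∂μ = 0 := by
  obtain ⟨A, hA⟩ := hc.exists_bound_of_continuous hφ.continuous
  obtain ⟨B, hB⟩ := (hc.fderiv ℝ).exists_bound_of_continuous (hφ.continuous_fderiv one_ne_zero)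
  have hmul : ∀ n p, fderiv ℝ (fun q => φ q * χ n q) p (E p)
      = φ p * fderiv ℝ (χ n) p (E p) + χ n p * fderiv ℝ φ p (E p) := fun n p => by
    rw [fderiv_fun_mul (hφ.differentiable one_ne_zero p) ((hχ n).differentiable one_ne_zero p)]
    simp only [add_apply, smul_apply, smul_eq_mul]
  have htendsto := tendsto_integral_of_dominated_convergence (μ := μ)
    (F := fun n p => fderiv ℝ (fun q => φ q * χ n q) p (E p)) (f := fun p => fderiv ℝ φ p (E p))
    (fun p => A * C + B * ‖E p‖)
    (fun n => isBoundedBilinearMap_apply.continuous.comp_aestronglyMeasurable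
      (((hφ.mul (hχ n)).continuous_fderiv one_ne_zero).aestronglyMeasurable.prodMk
        hE.aestronglyMeasurable))
    ((integrable_const _).add (hE.norm.const_mul B)) (fun n => ?_) ?_
  · simpa only [hzero, tendsto_const_nhds_iff, eq_comm] using htendsto
  · filter_upwards [hχE] with p hp
    rw [hmul, Real.norm_eq_abs]
    refine (abs_add_le _ _).trans (add_le_add ?_ ?_)
    · rw [abs_mul]
      exact mul_le_mul (hA p) (hp n) (abs_nonneg _) ((norm_nonneg _).trans (hA p))
    · rw [abs_mul]
      exact (mul_le_of_le_one_left (abs_nonneg _) (hχ1 n p)).trans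
        ((fderiv ℝ φ p).le_of_opNorm_le (hB p) (E p))
  · filter_upwards [hlim] with p hp
    refine tendsto_const_nhds.congr' ?_
    filter_upwards [hp] with n hn
    rw [hmul, hn.fderiv_eq, hn.self_of_nhds]
    simp

/-- A smooth function equal to `0` where `n |t| ≤ 1` and to `1` where `n |t| ≥ √2`. -/
def axisCutoff (n : ℕ) (t : ℝ) : ℝ := Real.smoothTransition ((n : ℝ) ^ 2 * t ^ 2 - 1)

lemma contDiff_axisCutoff (n : ℕ) : ContDiff ℝ ∞ (axisCutoff n) :=
  Real.smoothTransition.contDiff.comp (by fun_prop)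

lemma abs_axisCutoff_le_one (n : ℕ) (t : ℝ) : |axisCutoff n t| ≤ 1 := by
  rw [axisCutoff, abs_of_nonneg (Real.smoothTransition.nonneg _)]
  exact Real.smoothTransition.le_one _

lemma deriv_smoothTransition_eq_zero {s : ℝ} (hs : s ∉ Icc (0 : ℝ) 1) :
    deriv Real.smoothTransition s = 0 := by
  rw [mem_Icc, not_and_or, not_le, not_le] at hs
  rcases hs with hs | hs
  · refine (EventuallyEq.deriv_eq (f := fun _ => 0) ?_).trans (deriv_const s 0)
    filter_upwards [gt_mem_nhds hs] with t ht
    exact Real.smoothTransition.zero_of_nonpos ht.le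
  · refine (EventuallyEq.deriv_eq (f := fun _ => 1) ?_).trans (deriv_const s 1)
    filter_upwards [lt_mem_nhds hs] with t ht
    exact Real.smoothTransition.one_of_one_le ht.le

/-- `t ψ'(n t) n` is a function of `n t` only, hence bounded independently of `n`. -/
lemma exists_abs_mul_deriv_axisCutoff_le :
    ∃ C, ∀ (n : ℕ) (t : ℝ), |t * deriv (axisCutoff n) t| ≤ C := by
  have hT : ContDiff ℝ 1 Real.smoothTransition := Real.smoothTransition.contDiff
  have hcont : Continuous (fun s => deriv Real.smoothTransition s * (2 * (s + 1))) :=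
    (hT.continuous_deriv le_rfl).mul (by fun_prop)
  obtain ⟨C, hC⟩ := isCompact_Icc.exists_bound_of_continuousOn
    (s := Icc (0 : ℝ) 1) hcont.continuousOn
  refine ⟨max C 0, fun n t => ?_⟩
  set s := (n : ℝ) ^ 2 * t ^ 2 - 1 with hs
  have hderiv : HasDerivAt (axisCutoff n)
      (deriv Real.smoothTransition s * ((n : ℝ) ^ 2 * (2 * t))) t := by
    refine ((hT.differentiable one_ne_zero s).hasDerivAt).comp t ?_
    simpa using ((hasDerivAt_pow 2 t).const_mul ((n : ℝ) ^ 2)).sub_const 1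
  have hfun : t * deriv (axisCutoff n) t = deriv Real.smoothTransition s * (2 * (s + 1)) := by
    rw [hderiv.deriv, hs]
    ring
  rw [hfun]
  by_cases hs' : s ∈ Icc (0 : ℝ) 1
  · exact (hC s hs').trans (le_max_left _ _)
  · rw [deriv_smoothTransition_eq_zero hs', zero_mul, abs_zero]
    exact le_max_right _ _

lemma eventually_axisCutoff_eventuallyEq_one {t : ℝ} (ht : t ≠ 0) :
    ∀ᶠ n : ℕ in atTop, axisCutoff n =ᶠ[𝓝 t] 1 := by
  have hlim : Tendsto (fun n : ℕ => (n : ℝ) ^ 2 * t ^ 2 - 1) atTop atTop :=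
    tendsto_atTop_add_const_right _ _ (Tendsto.atTop_mul_const (by positivity)
      ((tendsto_pow_atTop two_ne_zero).comp tendsto_natCast_atTop_atTop))
  filter_upwards [hlim.eventually_gt_atTop 1] with n hn
  have hcont : Continuous fun s : ℝ => (n : ℝ) ^ 2 * s ^ 2 - 1 := by fun_prop
  filter_upwards [hcont.continuousAt.eventually_const_lt hn] with s hs
  exact Real.smoothTransition.one_of_one_le hs.le

/-- A smooth function vanishing near the axes, which tends to `1` off the axes as `n → ∞`. -/
def planeCutoff (n : ℕ) (p : ℝ × ℝ) : ℝ := axisCutoff n p.1 * axisCutoff n p.2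

lemma contDiff_planeCutoff (n : ℕ) : ContDiff ℝ ∞ (planeCutoff n) :=
  ((contDiff_axisCutoff n).comp contDiff_fst).mul ((contDiff_axisCutoff n).comp contDiff_snd)

lemma abs_planeCutoff_le_one (n : ℕ) (p : ℝ × ℝ) : |planeCutoff n p| ≤ 1 := by
  rw [planeCutoff, abs_mul]
  exact mul_le_one₀ (abs_axisCutoff_le_one n _) (abs_nonneg _) (abs_axisCutoff_le_one n _)

lemma ne_zero_of_mem_tsupport_planeCutoff {n : ℕ} {p : ℝ × ℝ} (hp : p ∈ tsupport (planeCutoff n)) :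
    p.1 ≠ 0 ∧ p.2 ≠ 0 := by
  have hclosed : IsClosed {q : ℝ × ℝ | 1 ≤ (n : ℝ) ^ 2 * q.1 ^ 2 ∧ 1 ≤ (n : ℝ) ^ 2 * q.2 ^ 2} := by
    rw [ofPred_and]
    exact (isClosed_le (by fun_prop) (by fun_prop)).inter (isClosed_le (by fun_prop) (by fun_prop))
  have hsupp : Function.support (planeCutoff n)
      ⊆ {q : ℝ × ℝ | 1 ≤ (n : ℝ) ^ 2 * q.1 ^ 2 ∧ 1 ≤ (n : ℝ) ^ 2 * q.2 ^ 2} := by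
    intro q hq
    have hone : ∀ t, axisCutoff n t ≠ 0 → 1 ≤ (n : ℝ) ^ 2 * t ^ 2 := fun t ht => by
      contrapose! ht
      exact Real.smoothTransition.zero_of_nonpos (sub_nonpos.2 ht.le)
    exact ⟨hone _ (left_ne_zero_of_mul hq), hone _ (right_ne_zero_of_mul hq)⟩
  have hmem := closure_minimal hsupp hclosed hp
  constructor <;> intro h0 <;> norm_num [h0] at hmem

lemma eventually_planeCutoff_eventuallyEq_one {p : ℝ × ℝ} (h1 : p.1 ≠ 0) (h2 : p.2 ≠ 0) :
    ∀ᶠ n : ℕ in atTop, planeCutoff n =ᶠ[𝓝 p] 1 := by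
  filter_upwards [eventually_axisCutoff_eventuallyEq_one h1,
    eventually_axisCutoff_eventuallyEq_one h2] with n hn1 hn2
  filter_upwards [continuousAt_fst.eventually hn1, continuousAt_snd.eventually hn2] with q hq1 hq2
  simp only [planeCutoff, hq1, hq2, Pi.one_apply, mul_one]

lemma exists_abs_fderiv_planeCutoff_le :
    ∃ D, ∀ (n : ℕ) (p v : ℝ × ℝ) (C : ℝ), 0 ≤ C → |v.1| ≤ C * |p.1| → |v.2| ≤ C * |p.2| →
      |fderiv ℝ (planeCutoff n) p v| ≤ C * D := by
  obtain ⟨D, hD⟩ := exists_abs_mul_deriv_axisCutoff_le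
  refine ⟨D + D, fun n p v C hC h1 h2 => ?_⟩
  have hd : ∀ t, HasDerivAt (axisCutoff n) (deriv (axisCutoff n) t) t := fun t =>
    ((contDiff_axisCutoff n).differentiable (by simp) t).hasDerivAt
  have hterm : ∀ s t w : ℝ, |w| ≤ C * |t| →
      |axisCutoff n s * (deriv (axisCutoff n) t * w)| ≤ C * D := fun s t w hw => by
    rw [abs_mul]
    refine (mul_le_of_le_one_left (abs_nonneg _) (abs_axisCutoff_le_one n s)).trans ?_
    calc |deriv (axisCutoff n) t * w| ≤ |deriv (axisCutoff n) t| * (C * |t|) := by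
          rw [abs_mul]; gcongr
      _ = C * |t * deriv (axisCutoff n) t| := by rw [abs_mul]; ring
      _ ≤ C * D := mul_le_mul_of_nonneg_left (hD n t) hC
  have hfst : HasFDerivAt Prod.fst (ContinuousLinearMap.fst ℝ ℝ ℝ) p := hasFDerivAt_fst
  have hsnd : HasFDerivAt Prod.snd (ContinuousLinearMap.snd ℝ ℝ ℝ) p := hasFDerivAt_snd
  have hfd : HasFDerivAt (planeCutoff n) _ p :=
    ((hd p.1).comp_hasFDerivAt p hfst).mul ((hd p.2).comp_hasFDerivAt p hsnd)
  rw [hfd.fderiv]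
  simp only [add_apply, smul_apply, ContinuousLinearMap.coe_fst', ContinuousLinearMap.coe_snd',
    smul_eq_mul, Function.comp]
  rw [mul_add]
  exact (abs_add_le _ _).trans (add_le_add (hterm _ _ _ h2) (hterm _ _ _ h1))

end Cutoff

/-! ### Realizability -/

section Bounds

variable {α : ℝ} {f k h : ℝ → ℝ}

lemma IsProfile.exists_abs_log_der1_sub_log_le (P : IsProfile α h) :
    ∃ C, ∀ x ∈ Icc (-α) α, x ≠ 0 → |Real.log (der1 α h x) - Real.log x| ≤ C := by
  obtain ⟨m, M, hm, hM, hbound⟩ := P.exists_der1_bounds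
  refine ⟨max |Real.log m| |Real.log M|, fun x hx hx0 => ?_⟩
  obtain ⟨hlow, hupp⟩ := hbound x hx
  have hx1 := abs_pos.2 hx0
  have h1 := Real.log_le_log (mul_pos hm hx1) hlow
  have h2 := Real.log_le_log ((mul_pos hm hx1).trans_le hlow) hupp
  rw [Real.log_mul hm.ne' hx1.ne', Real.log_abs, Real.log_abs] at h1
  rw [Real.log_mul hM.ne' hx1.ne', Real.log_abs, Real.log_abs] at h2
  exact abs_le_max_abs_abs (by linarith) (by linarith)

lemma IsProfile.exists_abs_log_der1_sub_le (P : IsProfile α h) (hL : LogBounded α h) :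
    ∃ C, ∀ x ∈ Ioo (-α) α, x ≠ 0 →
      |Real.log (der1 α h x) - der2 α h 0 * timePrimitive α h x| ≤ C := by
  obtain ⟨C₀, hC₀⟩ := hL
  obtain ⟨C₁, hC₁⟩ := P.exists_abs_log_der1_sub_log_le
  obtain ⟨ε, hε, hball⟩ := Metric.eventually_nhds_iff.1 (eventually_nhdsWithin_iff.1 hC₀)
  have ha := P.der2_pos
  have hfar : ContinuousOn (fun x => Real.log (der1 α h x) - der2 α h 0 * timePrimitive α h x)
      (Icc (-α) α ∩ {x | ε ≤ |x|}) := by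
    intro x hx
    have hx0 : x ≠ 0 := abs_pos.1 (hε.trans_le hx.2)
    exact (((P.contDiffOn_der1.continuousOn x hx.1).log (P.der1_ne_zero hx.1 hx0)).sub
      (continuousWithinAt_const.mul
        (P.hasDerivWithinAt_timePrimitive hx.1 hx0).continuousWithinAt)).mono inter_subset_left
  obtain ⟨C₂, hC₂⟩ := (isCompact_Icc.inter_right
    (isClosed_le continuous_const continuous_abs)).exists_bound_of_continuousOn hfar
  refine ⟨max (C₁ + der2 α h 0 * C₀) C₂, fun x hx hx0 => ?_⟩
  rcases le_or_gt ε |x| with hxε | hxε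
  · exact (hC₂ x ⟨Ioo_subset_Icc_self hx, hxε⟩).trans (le_max_right _ _)
  refine le_trans ?_ (le_max_left _ _)
  have hnear := hball (by rwa [Real.dist_eq, sub_zero]) hx0
  rw [Real.log_abs] at hnear
  have hsplit : Real.log (der1 α h x) - der2 α h 0 * timePrimitive α h x
      = (Real.log (der1 α h x) - Real.log x)
        - der2 α h 0 * (timePrimitive α h x - Real.log x / der2 α h 0) := by
    field_simp
    ring
  rw [hsplit]
  refine (abs_sub _ _).trans (add_le_add (hC₁ x (Ioo_subset_Icc_self hx) hx0) ?_)
  rw [abs_mul, abs_of_pos ha]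
  exact mul_le_mul_of_nonneg_left hnear ha.le

/- As `F(x) - G(y)` takes the same value at `p` and at its hitting point, the terms `a F` and `a G`
cancel when the rates `a = f''(0) = k''(0)` agree. -/
lemma exists_abs_hitWeight_le (Pf : IsProfile α f) (Pk : IsProfile α k)
    (hf : LogBounded α f) (hk : LogBounded α k) (hfk : der2 α f 0 = der2 α k 0) :
    ∃ C, ∀ p ∈ regionQ α f (fun t => -k t), p.1 ≠ 0 → p.2 ≠ 0 → |hitWeight α f k p| ≤ C := by
  obtain ⟨C₁, h1⟩ := Pf.exists_abs_log_der1_sub_le hf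
  obtain ⟨C₂, h2⟩ := Pk.exists_abs_log_der1_sub_le hk
  refine ⟨2 * C₁ + 2 * C₂, fun p hp p1 p2 => ?_⟩
  have hpI := mem_interior_squareK.1 hp.1
  have hz := isHitPoint_hitPoint Pf Pk hp p1 p2
  have hz1 := abs_le.1 (h1 _ (fst_mem_of_mem_openQuadrant hz.mem)
    (fst_ne_zero_of_mem_openQuadrant hz.mem))
  have hz2 := abs_le.1 (h2 _ (snd_mem_of_mem_openQuadrant hz.mem)
    (snd_ne_zero_of_mem_openQuadrant hz.mem))
  have hp1 := abs_le.1 (h1 _ hpI.1 p1)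
  have hp2 := abs_le.1 (h2 _ hpI.2 p2)
  have htime := congrArg (der2 α k 0 * ·) hz.time_eq
  simp only [mul_add] at htime
  rw [hfk] at hz1 hp1
  rw [hitWeight, hitLog, abs_le]
  constructor <;> linarith [hz1.1, hz1.2, hz2.1, hz2.2, hp1.1, hp1.2, hp2.1, hp2.2]

end Bounds

section Realize

variable {α C : ℝ} {f k : ℝ → ℝ} {σ φ : ℝ × ℝ → ℝ} {p : ℝ × ℝ} {Ω : Set (ℝ × ℝ)}

lemma volume_axes (α : ℝ) :
    (volume : Measure (ℝ × ℝ)) (stableCurve α ∪ unstableCurve α) = 0 := by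
  rw [measure_union_null_iff, stableCurve, unstableCurve, Measure.volume_eq_prod,
    Measure.prod_prod, Measure.prod_prod]
  simp

lemma restrict_diff_axes (α : ℝ) (S : Set (ℝ × ℝ)) :
    volume.restrict (S \ (stableCurve α ∪ unstableCurve α)) = volume.restrict S :=
  Measure.restrict_congr_set (sdiff_null_ae_eq_self (volume_axes α))

lemma isFiniteMeasure_restrict_of_subset_squareK (hΩ : Ω ⊆ squareK α) :
    IsFiniteMeasure (volume.restrict Ω) :=
  isFiniteMeasure_restrict.2
    ((measure_mono hΩ).trans_lt (isCompact_Icc.prod isCompact_Icc).measure_lt_top).ne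

lemma contDiffOn_planeGrad_sepPotential (Pf : IsProfile α f) (Pk : IsProfile α k) :
    ContDiffOn ℝ 1 (planeGrad (sepPotential f (fun t => -k t))) (interior (squareK α)) := by
  have hmaps : ∀ p ∈ interior (squareK α), p ∈ squareK α := fun p hp => interior_subset hp
  refine ContDiffOn.congr ?_ fun p hp => planeGrad_sepPotential Pf Pk hp
  exact (Pf.contDiffOn_der1.comp contDiff_fst.contDiffOn fun p hp => (hmaps p hp).1).prodMk
    (Pk.contDiffOn_der1.comp contDiff_snd.contDiffOn fun p hp => (hmaps p hp).2).neg

lemma memLp_top_of_forall_diff_axes (hΩ : Ω ⊆ squareK α) (hΩo : IsOpen Ω)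
    (hσ : ContinuousOn σ (Ω \ (stableCurve α ∪ unstableCurve α)))
    (hC : ∀ p ∈ Ω \ (stableCurve α ∪ unstableCurve α), |σ p| ≤ C) : MemLinf Ω σ := by
  have hU := (isOpen_diff_axes hΩ hΩo).measurableSet
  rw [MemLinf, ← restrict_diff_axes α]
  exact memLp_top_of_bound (hσ.aestronglyMeasurable hU) C
    ((ae_restrict_mem hU).mono fun p hp => hC p hp)

lemma exists_abs_smul_planeGrad_le (Pf : IsProfile α f) (Pk : IsProfile α k)
    (hΩ : Ω ⊆ interior (squareK α)) (hC : ∀ p ∈ Ω, |σ p| ≤ C) :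
    ∃ A, 0 ≤ A ∧ ∀ p ∈ Ω, |(σ p • planeGrad (sepPotential f (fun t => -k t)) p).1| ≤ A * |p.1| ∧
      |(σ p • planeGrad (sepPotential f (fun t => -k t)) p).2| ≤ A * |p.2| := by
  obtain ⟨_, M, _, hM, hbf⟩ := Pf.exists_der1_bounds
  obtain ⟨_, M', _, _, hbk⟩ := Pk.exists_der1_bounds
  have hprod : ∀ {p : ℝ × ℝ} {d N t : ℝ}, p ∈ Ω → |d| ≤ N * |t| → N ≤ max M M' →
      |σ p * d| ≤ max C 0 * max M M' * |t| := fun {p d N t} hp hd hN => by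
    rw [abs_mul, mul_assoc]
    exact mul_le_mul ((hC p hp).trans (le_max_left _ _))
      (hd.trans (mul_le_mul_of_nonneg_right hN (abs_nonneg t))) (abs_nonneg d) (le_max_right _ _)
  refine ⟨max C 0 * max M M', mul_nonneg (le_max_right _ _) (hM.le.trans (le_max_left _ _)),
    fun p hp => ?_⟩
  have hpI := mem_interior_squareK.1 (hΩ hp)
  rw [planeGrad_sepPotential Pf Pk (hΩ hp)]
  exact ⟨hprod hp (hbf p.1 (Ioo_subset_Icc_self hpI.1)).2 (le_max_left _ _),
    hprod hp ((abs_neg _).trans_le (hbk p.2 (Ioo_subset_Icc_self hpI.2)).2) (le_max_right _ _)⟩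

/- The flux vanishes on the axes at least linearly in the normal component, which compensates for
the blow-up of the gradient of the cutoff functions. -/
lemma setIntegral_fderiv_smul_planeGrad_eq_zero (Pf : IsProfile α f) (Pk : IsProfile α k)
    (hΩ : Ω ⊆ interior (squareK α)) (hΩo : IsOpen Ω)
    (hσ : ContDiffOn ℝ 1 σ (Ω \ (stableCurve α ∪ unstableCurve α)))
    (hC : ∀ p ∈ Ω \ (stableCurve α ∪ unstableCurve α), |σ p| ≤ C)
    (hdiv : ∀ p ∈ Ω \ (stableCurve α ∪ unstableCurve α),
      planeDiv (fun q => σ q • planeGrad (sepPotential f (fun t => -k t)) q) p = 0)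
    (hφ : ContDiff ℝ 1 φ) (hφc : HasCompactSupport φ) (hφs : tsupport φ ⊆ Ω) :
    ∫ p in Ω, fderiv ℝ φ p (σ p • planeGrad (sepPotential f (fun t => -k t)) p) = 0 := by
  set u := sepPotential f (fun t => -k t)
  have hΩK : Ω ⊆ squareK α := hΩ.trans interior_subset
  have hUo := isOpen_diff_axes hΩK hΩo
  have := isFiniteMeasure_restrict_of_subset_squareK hΩK
  have hE : ContDiffOn ℝ 1 (fun p => σ p • planeGrad u p)
      (Ω \ (stableCurve α ∪ unstableCurve α)) :=
    hσ.smul ((contDiffOn_planeGrad_sepPotential Pf Pk).mono (sdiff_subset.trans hΩ))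
  have hmem : ∀ᵐ p ∂(volume.restrict Ω), p ∈ Ω \ (stableCurve α ∪ unstableCurve α) := by
    rw [← restrict_diff_axes α]
    exact ae_restrict_mem hUo.measurableSet
  obtain ⟨A, hA0, hA⟩ := exists_abs_smul_planeGrad_le Pf Pk (sdiff_subset.trans hΩ) hC
  obtain ⟨D, hD⟩ := exists_abs_fderiv_planeCutoff_le
  have hcut : ∀ n, ContDiff ℝ 1 (planeCutoff n) := fun n =>
    (contDiff_planeCutoff n).of_le (mod_cast le_top)
  refine integral_fderiv_apply_eq_zero_of_cutoff (χ := planeCutoff) (C := A * D) ?_ hφ hφc hcut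
    abs_planeCutoff_le_one ?_ ?_ fun n => ?_
  · refine Integrable.of_bound ?_ (A * α) (hmem.mono fun p hp => ?_)
    · rw [← restrict_diff_axes α]
      exact hE.continuousOn.aestronglyMeasurable hUo.measurableSet
    · have hpK := hΩK hp.1
      exact max_le ((hA p hp).1.trans (mul_le_mul_of_nonneg_left (abs_le.2 hpK.1) hA0))
        ((hA p hp).2.trans (mul_le_mul_of_nonneg_left (abs_le.2 hpK.2) hA0))
  · exact hmem.mono fun p hp n => hD n p _ A hA0 (hA p hp).1 (hA p hp).2
  · filter_upwards [hmem] with p hp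
    obtain ⟨-, h1, h2⟩ := (mem_diff_axes_iff hΩK).1 hp
    exact eventually_planeCutoff_eventuallyEq_one h1 h2
  · exact setIntegral_fderiv_apply_eq_zero_of_planeDiv_eq_zero hUo sdiff_subset hE hdiv
      (hφ.mul (hcut n)) hφc.mul_right fun p hp => (mem_diff_axes_iff hΩK).2
        ⟨hφs (tsupport_mul_subset_left hp),
          ne_zero_of_mem_tsupport_planeCutoff (tsupport_mul_subset_right hp)⟩

lemma planeDiv_exp_hitWeight_smul_planeGrad (Pf : IsProfile α f) (Pk : IsProfile α k)
    (hp : p ∈ regionQ α f (fun t => -k t)) (h1 : p.1 ≠ 0) (h2 : p.2 ≠ 0) :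
    planeDiv (fun q => Real.exp (hitWeight α f k q) •
      planeGrad (sepPotential f (fun t => -k t)) q) p = 0 := by
  have hw := (contDiffAt_hitWeight Pf Pk hp h1 h2).differentiableAt one_ne_zero
  have hu := ((contDiffOn_planeGrad_sepPotential Pf Pk).contDiffAt
    (isOpen_interior.mem_nhds hp.1)).differentiableAt one_ne_zero
  rw [planeDiv_smul hw.exp hu, planeDiv_planeGrad hu, fderiv_exp hw, smul_apply, smul_eq_mul,
    planeGrad_sepPotential Pf Pk hp.1, fderiv_hitWeight Pf Pk hp h1 h2,
    planeLaplacian_sepPotential Pf Pk hp.1]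
  ring

lemma contDiffOn_hitWeight (Pf : IsProfile α f) (Pk : IsProfile α k) :
    ContDiffOn ℝ 1 (hitWeight α f k)
      (regionQ α f (fun t => -k t) \ (stableCurve α ∪ unstableCurve α)) := fun _ hp => by
  obtain ⟨hpQ, h1, h2⟩ :=
    (mem_diff_axes_iff ((regionQ_subset_interior α _ _).trans interior_subset)).1 hp
  exact (contDiffAt_hitWeight Pf Pk hpQ h1 h2).contDiffWithinAt

lemma exists_isRealizableWith (Pf : IsProfile α f) (Pk : IsProfile α k)
    (hC : ∀ p ∈ regionQ α f (fun t => -k t), p.1 ≠ 0 → p.2 ≠ 0 → |hitWeight α f k p| ≤ C) :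
    ∃ σ : ℝ × ℝ → ℝ,
      IsRealizableWith (sepPotential f (fun t => -k t)) (regionQ α f (fun t => -k t)) σ ∧
      MemLinfLoc (regionQ α f (fun t => -k t)) σ ∧
      MemLinfLoc (regionQ α f (fun t => -k t)) (fun p => (σ p)⁻¹) ∧
      ContDiffOn ℝ 1 σ (regionQ α f (fun t => -k t) \ (stableCurve α ∪ unstableCurve α)) ∧
      ContDiffOn ℝ 1 (fun p => (σ p)⁻¹)
        (regionQ α f (fun t => -k t) \ (stableCurve α ∪ unstableCurve α)) := by
  have hQ := regionQ_subset_interior α f (fun t => -k t)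
  have hQK := hQ.trans interior_subset
  have hQo := isOpen_regionQ Pf Pk
  have := isFiniteMeasure_restrict_of_subset_squareK hQK
  have hwC : ∀ p ∈ regionQ α f (fun t => -k t) \ (stableCurve α ∪ unstableCurve α),
      |hitWeight α f k p| ≤ C := fun p hp =>
    have ⟨hpQ, h1, h2⟩ := (mem_diff_axes_iff hQK).1 hp
    hC p hpQ h1 h2
  have hσ := (contDiffOn_hitWeight Pf Pk).exp
  have hσ' : ContDiffOn ℝ 1 (fun p => (Real.exp (hitWeight α f k p))⁻¹)
      (regionQ α f (fun t => -k t) \ (stableCurve α ∪ unstableCurve α)) := by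
    simpa only [← Real.exp_neg] using (contDiffOn_hitWeight Pf Pk).neg.exp
  have hbound : ∀ p ∈ regionQ α f (fun t => -k t) \ (stableCurve α ∪ unstableCurve α),
      |Real.exp (hitWeight α f k p)| ≤ Real.exp C := fun p hp => by
    rw [Real.abs_exp, Real.exp_le_exp]
    exact (abs_le.1 (hwC p hp)).2
  have hbound' : ∀ p ∈ regionQ α f (fun t => -k t) \ (stableCurve α ∪ unstableCurve α),
      |(Real.exp (hitWeight α f k p))⁻¹| ≤ Real.exp C := fun p hp => by
    rw [← Real.exp_neg, Real.abs_exp, Real.exp_le_exp]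
    exact neg_le.1 (abs_le.1 (hwC p hp)).1
  have hL := memLp_top_of_forall_diff_axes hQK hQo hσ.continuousOn hbound
  have hL' := memLp_top_of_forall_diff_axes hQK hQo hσ'.continuousOn hbound'
  refine ⟨fun p => Real.exp (hitWeight α f k p), ⟨?_, ?_, fun φ hφ hφc hφs => ?_⟩,
    fun K _ hK => hL.mono_measure (Measure.restrict_mono hK le_rfl),
    fun K _ hK => hL'.mono_measure (Measure.restrict_mono hK le_rfl), hσ, hσ'⟩
  · exact Eventually.of_forall fun p => Real.exp_pos _
  · exact IntegrableOn.locallyIntegrableOn (hL.integrable le_top)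
  · have hφ1 : ContDiff ℝ 1 φ := hφ.of_le (mod_cast le_top)
    simpa only [fderiv_apply_smul_planeGrad (hφ1.differentiable one_ne_zero _)] using
      setIntegral_fderiv_smul_planeGrad_eq_zero Pf Pk hQ hQo hσ hbound
        (fun p hp => have ⟨hpQ, h1, h2⟩ := (mem_diff_axes_iff hQK).1 hp
          planeDiv_exp_hitWeight_smul_planeGrad Pf Pk hpQ h1 h2) hφ1 hφc hφs

end Realize

/-! ### Necessity of the condition on the Laplacian -/

section General

lemma mem_of_ae_restrict_mem {X Y : Type*} [TopologicalSpace X] [MeasurableSpace X]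
    [TopologicalSpace Y] {μ : Measure X} [μ.IsOpenPosMeasure] {U : Set X} (hU : IsOpen U)
    {σ : X → Y} (hσ : ContinuousOn σ U) {s : Set Y} (hs : IsClosed s)
    (h : ∀ᵐ p ∂(μ.restrict U), σ p ∈ s) {p : X} (hp : p ∈ U) : σ p ∈ s := by
  by_contra hps
  refine (hσ.isOpen_inter_preimage hU hs.isOpen_compl).measure_ne_zero μ ⟨p, hp, hps⟩ ?_
  rw [← Measure.restrict_eq_self μ inter_subset_left]
  exact measure_mono_null inter_subset_right (ae_iff.1 h)

lemma ae_norm_le_toReal_eLpNorm_top {X E : Type*} [MeasurableSpace X] [NormedAddCommGroup E]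
    {μ : Measure X} {σ : X → E} (h : MemLp σ ⊤ μ) : ∀ᵐ x ∂μ, ‖σ x‖ ≤ (eLpNorm σ ⊤ μ).toReal := by
  have hfin := h.2.ne
  rw [eLpNorm_exponent_top] at hfin ⊢
  filter_upwards [enorm_ae_le_eLpNormEssSup σ μ] with x hx
  rw [← toReal_enorm]
  exact ENNReal.toReal_mono hfin hx

lemma exists_pos_and_abs_log_le {X : Type*} [TopologicalSpace X] [MeasurableSpace X]
    {μ : Measure X} [μ.IsOpenPosMeasure] {U : Set X} (hU : IsOpen U) {σ : X → ℝ}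
    (hσ : ContinuousOn σ U) (hpos : ∀ᵐ p ∂(μ.restrict U), 0 < σ p)
    (h1 : MemLp σ ⊤ (μ.restrict U)) (h2 : MemLp (fun p => (σ p)⁻¹) ⊤ (μ.restrict U)) :
    ∃ C, ∀ p ∈ U, 0 < σ p ∧ |Real.log (σ p)| ≤ C := by
  set D := max 1 (max (eLpNorm σ ⊤ (μ.restrict U)).toReal
    (eLpNorm (fun p => (σ p)⁻¹) ⊤ (μ.restrict U)).toReal)
  have hD : 0 < D := lt_max_of_lt_left one_pos
  have hmem : ∀ p ∈ U, σ p ∈ Icc D⁻¹ D := fun p hp => by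
    refine mem_of_ae_restrict_mem (μ := μ) hU hσ isClosed_Icc ?_ hp
    filter_upwards [hpos, ae_norm_le_toReal_eLpNorm_top h1, ae_norm_le_toReal_eLpNorm_top h2]
      with q hq hq1 hq2
    rw [Real.norm_eq_abs] at hq1 hq2
    exact ⟨inv_le_of_inv_le₀ hq ((le_abs_self _).trans (hq2.trans (by simp [D]))),
      (le_abs_self _).trans (hq1.trans (by simp [D]))⟩
  refine ⟨Real.log D, fun p hp => ?_⟩
  have hσp : 0 < σ p := (inv_pos.2 hD).trans_le (hmem p hp).1
  refine ⟨hσp, abs_le.2 ⟨?_, Real.log_le_log hσp (hmem p hp).2⟩⟩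
  rw [← Real.log_inv]
  exact Real.log_le_log (inv_pos.2 hD) (hmem p hp).1

lemma eq_zero_of_tendsto_deriv_atBot_of_bounded {φ φ' : ℝ → ℝ} {L C : ℝ}
    (hφ : ∀ᶠ t in atBot, HasDerivAt φ (φ' t) t) (hL : Tendsto φ' atBot (𝓝 L))
    (hC : ∀ᶠ t in atBot, |φ t| ≤ C) : L = 0 := by
  by_contra hL0
  have hgrow : ∀ᶠ t in atBot, L ^ 2 / 2 ≤ L * φ' t :=
    ((hL.const_mul L).eventually (lt_mem_nhds (show L ^ 2 / 2 < L * L by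
      nlinarith [sq_pos_of_ne_zero hL0]))).mono fun _ => le_of_lt
  obtain ⟨a, ha⟩ := eventually_atBot.1 (hφ.and (hgrow.and hC))
  have hderiv : ∀ t ≤ a, HasDerivAt (fun s => L * φ s) (L * φ' t) t :=
    fun t ht => (ha t ht).1.const_mul L
  have hint : ∀ t ∈ interior (Iic a), t ≤ a := fun t ht => mem_Iic.1 (interior_subset ht)
  have hbound : ∀ n : ℝ, 0 ≤ n → L ^ 2 / 2 * n ≤ 2 * |L| * C := fun n hn => by
    have hmvt := (convex_Iic a).mul_sub_le_image_sub_of_le_deriv (C := L ^ 2 / 2)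
      (fun t ht => (hderiv t ht).continuousAt.continuousWithinAt)
      (fun t ht => (hderiv t (hint t ht)).differentiableAt.differentiableWithinAt)
      (fun t ht => (hderiv t (hint t ht)).deriv ▸ (ha t (hint t ht)).2.1)
      (a - n) (sub_le_self a hn) a self_mem_Iic (sub_le_self a hn)
    have hle : ∀ t ≤ a, |L * φ t| ≤ |L| * C := fun t ht => by
      rw [abs_mul]
      exact mul_le_mul_of_nonneg_left (ha t ht).2.2 (abs_nonneg L)
    linarith [le_abs_self (L * φ a), neg_abs_le (L * φ (a - n)), hle a le_rfl,
      hle (a - n) (sub_le_self a hn)]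
  have hunbounded := (tendsto_id.const_mul_atTop
    (half_pos (sq_pos_of_ne_zero hL0))).eventually_gt_atTop (2 * |L| * C)
  obtain ⟨n, hn, hn0⟩ := (hunbounded.and (eventually_ge_atTop 0)).exists
  exact hn.not_ge (hbound n hn0)

end General

section Converse

variable {α r S t : ℝ} {f k : ℝ → ℝ} {σ : ℝ × ℝ → ℝ} {p : ℝ × ℝ} {U V : Set (ℝ × ℝ)}

lemma fderiv_conductivity (Pf : IsProfile α f) (Pk : IsProfile α k)
    (hU : IsOpen U) (hUK : U ⊆ interior (squareK α)) (hUV : U ⊆ V) (hσ : ContDiffOn ℝ 1 σ U)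
    (hreal : IsRealizableWith (sepPotential f (fun t => -k t)) V σ) (hp : p ∈ U) :
    fderiv ℝ σ p (der1 α f p.1, -der1 α k p.2) = σ p * (der2 α k p.2 - der2 α f p.1) := by
  have hgrad := (contDiffOn_planeGrad_sepPotential Pf Pk).mono hUK
  have hdiv : planeDiv (fun q => σ q • planeGrad (sepPotential f (fun t => -k t)) q) p = 0 :=
    planeDiv_eq_zero_of_integral_eq_zero hU hUV (hσ.smul hgrad) (fun φ hφ hφc hφU => by
      simpa only [fderiv_apply_smul_planeGrad (hφ.differentiable (by simp) _)] using
        hreal.2.2 φ hφ hφc (hφU.trans hUV)) hp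
  have hσp := (hσ.contDiffAt (hU.mem_nhds hp)).differentiableAt one_ne_zero
  have hgradp := (hgrad.contDiffAt (hU.mem_nhds hp)).differentiableAt one_ne_zero
  rw [planeDiv_smul hσp hgradp, planeDiv_planeGrad hgradp, planeGrad_sepPotential Pf Pk (hUK hp),
    planeLaplacian_sepPotential Pf Pk (hUK hp)] at hdiv
  linarith

lemma conductivity_mul_der1_mul_der1_eq (Pf : IsProfile α f) (Pk : IsProfile α k)
    (hU : IsOpen U) (hUK : U ⊆ interior (squareK α)) (hUV : U ⊆ V) (hσ : ContDiffOn ℝ 1 σ U)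
    (hreal : IsRealizableWith (sepPotential f (fun t => -k t)) V σ) (hS : S < 0) (ht : t ≤ S)
    (hmem : ∀ s ∈ Icc t S, (sideInverse α f α s, sideInverse α k α (t + S - s)) ∈ U) :
    σ (sideInverse α f α S, sideInverse α k α t) * der1 α f (sideInverse α f α S)
        * der1 α k (sideInverse α k α t)
      = σ (sideInverse α f α t, sideInverse α k α S) * der1 α f (sideInverse α f α t)
        * der1 α k (sideInverse α k α S) := by
  set x := sideInverse α f α
  set y := fun s => sideInverse α k α (t + S - s)
  have hα0 : α ≠ 0 := Pf.radius_pos.ne'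
  have hderiv : ∀ s ∈ Icc t S,
      HasDerivAt (fun s => σ (x s, y s) * der1 α f (x s) * der1 α k (y s)) 0 s := fun s hs => by
    have hxy := mem_interior_squareK.1 (hUK (hmem s hs))
    have hx : HasDerivAt x (der1 α f (x s)) s :=
      Pf.hasDerivAt_sideInverse hα0 (hs.2.trans_lt hS)
    have hy : HasDerivAt y (-der1 α k (y s)) s :=
      (Pk.hasDerivAt_sideInverse hα0 (by linarith [hs.1])).comp_const_sub _ _
    have hσxy := ((hσ.contDiffAt (hU.mem_nhds (hmem s hs))).differentiableAt
      one_ne_zero).hasFDerivAt.comp_hasDerivAt s (hx.prodMk hy)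
    rw [fderiv_conductivity Pf Pk hU hUK hUV hσ hreal (hmem s hs)] at hσxy
    have hf : HasDerivAt (fun s => der1 α f (x s)) (der2 α f (x s) * der1 α f (x s)) s :=
      (Pf.hasDerivAt_der1 hxy.1).comp s hx
    have hk : HasDerivAt (fun s => der1 α k (y s)) (der2 α k (y s) * -der1 α k (y s)) s :=
      (Pk.hasDerivAt_der1 hxy.2).comp s hy
    refine ((hσxy.mul hf).mul hk).congr_deriv ?_
    simp only [Function.comp, Pi.mul_apply, y]
    ring
  have hconst := constant_of_has_deriv_right_zero
    (fun s hs => (hderiv s hs).continuousAt.continuousWithinAt)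
    (fun s hs => (hderiv s (Ico_subset_Icc_self hs)).hasDerivWithinAt) S (right_mem_Icc.2 ht)
  simpa only [y, add_sub_cancel_right, add_sub_cancel_left] using hconst

lemma exists_Icc_prod_Icc_subset (hV : V ∈ 𝓝 ((0 : ℝ), (0 : ℝ))) :
    ∃ r, 0 < r ∧ Icc 0 r ×ˢ Icc 0 r ⊆ V := by
  obtain ⟨ε, hε, hb⟩ := Metric.nhds_basis_closedBall.mem_iff.1 hV
  refine ⟨ε, hε, Subset.trans ?_ hb⟩
  rw [← closedBall_prod_same, Real.closedBall_eq_Icc, zero_sub, zero_add]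
  exact prod_mono (Icc_subset_Icc_left (neg_nonpos.2 hε.le))
    (Icc_subset_Icc_left (neg_nonpos.2 hε.le))

lemma exists_abs_log_conductivity_le (hV : IsOpen V) (h0 : (0, 0) ∈ V) (hVK : V ⊆ squareK α)
    (hpos : ∀ᵐ p ∂(volume.restrict V), 0 < σ p)
    (h1 : MemLinfLoc V σ) (h2 : MemLinfLoc V (fun p => (σ p)⁻¹))
    (hσ : ContDiffOn ℝ 1 σ (V \ (stableCurve α ∪ unstableCurve α))) :
    ∃ r C, 0 < r ∧ Ioo 0 r ×ˢ Ioo 0 r ⊆ V ∧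
      ∀ p ∈ Ioo 0 r ×ˢ Ioo 0 r, 0 < σ p ∧ |Real.log (σ p)| ≤ C := by
  obtain ⟨r, hr, hrV⟩ := exists_Icc_prod_Icc_subset (hV.mem_nhds h0)
  have hUr : Ioo 0 r ×ˢ Ioo 0 r ⊆ Icc 0 r ×ˢ Icc 0 r :=
    prod_mono Ioo_subset_Icc_self Ioo_subset_Icc_self
  have hUV := hUr.trans hrV
  have hσU : ContinuousOn σ (Ioo 0 r ×ˢ Ioo 0 r) := hσ.continuousOn.mono fun p hp =>
    (mem_diff_axes_iff hVK).2 ⟨hUV hp, hp.1.1.ne', hp.2.1.ne'⟩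
  have hcomp : IsCompact (Icc (0 : ℝ) r ×ˢ Icc (0 : ℝ) r) := isCompact_Icc.prod isCompact_Icc
  obtain ⟨C, hC⟩ := exists_pos_and_abs_log_le (isOpen_Ioo.prod isOpen_Ioo) hσU
    (ae_restrict_of_ae_restrict_of_subset hUV hpos)
    ((h1 _ hcomp hrV).mono_measure (Measure.restrict_mono hUr le_rfl))
    ((h2 _ hcomp hrV).mono_measure (Measure.restrict_mono hUr le_rfl))
  exact ⟨r, C, hr, hUV, hC⟩

lemma IsProfile.eventually_sideInverse_mem_Ioo {h : ℝ → ℝ} (P : IsProfile α h) (hr : 0 < r) :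
    ∀ᶠ t in atBot, sideInverse α h α t ∈ Ioo 0 r := by
  filter_upwards [(P.tendsto_sideInverse P.radius_pos.ne').eventually (gt_mem_nhds hr),
    eventually_le_atBot 0] with t ht ht0
  exact ⟨pos_of_mul_pos_left (P.sideInverse_mul_pos P.radius_pos.ne' ht0) P.radius_pos.le, ht⟩

/- The trajectory from `(F⁻¹(t), G⁻¹(-S))` reaches `(F⁻¹(S), G⁻¹(-t))` at time `S - t`, and
`σ f' g'` is constant along it. -/
lemma exists_eventually_abs_log_der1_sub_le (Pf : IsProfile α f) (Pk : IsProfile α k)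
    (hV : IsOpen V) (h0 : (0, 0) ∈ V) (hVK : V ⊆ squareK α)
    (hreal : IsRealizableWith (sepPotential f (fun t => -k t)) V σ)
    (h1 : MemLinfLoc V σ) (h2 : MemLinfLoc V (fun p => (σ p)⁻¹))
    (hσ : ContDiffOn ℝ 1 σ (V \ (stableCurve α ∪ unstableCurve α))) :
    ∃ C, ∀ᶠ t in atBot, |Real.log (der1 α f (sideInverse α f α t))
      - Real.log (der1 α k (sideInverse α k α t))| ≤ C := by
  obtain ⟨r, C, hr, hUV, hC⟩ := exists_abs_log_conductivity_le hV h0 hVK hreal.1 h1 h2 hσ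
  set U := Ioo 0 r ×ˢ Ioo 0 r
  have hU : IsOpen U := isOpen_Ioo.prod isOpen_Ioo
  have hUK : U ⊆ interior (squareK α) := hU.subset_interior_iff.2 (hUV.trans hVK)
  have hσU : ContDiffOn ℝ 1 σ U :=
    hσ.mono fun p hp => (mem_diff_axes_iff hVK).2 ⟨hUV hp, hp.1.1.ne', hp.2.1.ne'⟩
  obtain ⟨S, hS⟩ := eventually_atBot.1 ((eventually_lt_atBot (0 : ℝ)).and
    ((Pf.eventually_sideInverse_mem_Ioo hr).and (Pk.eventually_sideInverse_mem_Ioo hr)))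
  have hmem : ∀ s ≤ S, ∀ t ≤ S, (sideInverse α f α s, sideInverse α k α t) ∈ U :=
    fun s hs t ht => ⟨(hS s hs).2.1, (hS t ht).2.2⟩
  refine ⟨2 * C + |Real.log (der1 α f (sideInverse α f α S))
    - Real.log (der1 α k (sideInverse α k α S))|, eventually_atBot.2 ⟨S, fun t ht => ?_⟩⟩
  have hf0 : ∀ s ≤ S, der1 α f (sideInverse α f α s) ≠ 0 := fun s hs =>
    have hs' := hmem s hs s hs
    Pf.der1_ne_zero (interior_subset (hUK hs')).1 hs'.1.1.ne'
  have hk0 : ∀ s ≤ S, der1 α k (sideInverse α k α s) ≠ 0 := fun s hs =>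
    have hs' := hmem s hs s hs
    Pk.der1_ne_zero (interior_subset (hUK hs')).2 hs'.2.1.ne'
  obtain ⟨hσ1, hlog1⟩ := hC _ (hmem S le_rfl t ht)
  obtain ⟨hσ2, hlog2⟩ := hC _ (hmem t ht S le_rfl)
  have heq := congrArg Real.log (conductivity_mul_der1_mul_der1_eq Pf Pk hU hUK hUV hσU hreal
    (hS S le_rfl).1 ht fun s hs => hmem s hs.2 _ (by linarith [hs.1]))
  rw [Real.log_mul (mul_ne_zero hσ1.ne' (hf0 S le_rfl)) (hk0 t ht),
    Real.log_mul hσ1.ne' (hf0 S le_rfl), Real.log_mul (mul_ne_zero hσ2.ne' (hf0 t ht))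
    (hk0 S le_rfl), Real.log_mul hσ2.ne' (hf0 t ht)] at heq
  rw [abs_le] at hlog1 hlog2 ⊢
  have hle := le_abs_self (Real.log (der1 α f (sideInverse α f α S))
    - Real.log (der1 α k (sideInverse α k α S)))
  have hge := neg_abs_le (Real.log (der1 α f (sideInverse α f α S))
    - Real.log (der1 α k (sideInverse α k α S)))
  constructor <;> linarith

lemma IsProfile.hasDerivAt_log_der1_sideInverse {h : ℝ → ℝ} (P : IsProfile α h) (ht : t < 0) :
    HasDerivAt (fun s => Real.log (der1 α h (sideInverse α h α s)))
      (der2 α h (sideInverse α h α t)) t := by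
  have hα0 := P.radius_pos.ne'
  have hz := P.sideInverse_mem_Ioo hα0 ht
  have hd := P.der1_ne_zero (Ioo_subset_Icc_self hz) (P.sideInverse_ne_zero hα0 ht.le)
  refine (((P.hasDerivAt_der1 hz).comp t (P.hasDerivAt_sideInverse hα0 ht)).log hd).congr_deriv ?_
  exact mul_div_cancel_right₀ _ hd

lemma IsProfile.tendsto_der2_sideInverse {h : ℝ → ℝ} (P : IsProfile α h) :
    Tendsto (fun t => der2 α h (sideInverse α h α t)) atBot (𝓝 (der2 α h 0)) :=
  (P.continuousOn_der2.continuousAt (Icc_mem_nhds P.zero_mem.1 P.zero_mem.2)).tendsto.comp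
    (P.tendsto_sideInverse P.radius_pos.ne')

lemma der2_zero_eq_of_eventually_abs_log_der1_sub_le {C : ℝ} (Pf : IsProfile α f)
    (Pk : IsProfile α k)
    (hC : ∀ᶠ t in atBot, |Real.log (der1 α f (sideInverse α f α t))
      - Real.log (der1 α k (sideInverse α k α t))| ≤ C) :
    der2 α f 0 = der2 α k 0 := by
  refine sub_eq_zero.1 (eq_zero_of_tendsto_deriv_atBot_of_bounded ?_
    (Pf.tendsto_der2_sideInverse.sub Pk.tendsto_der2_sideInverse) hC)
  filter_upwards [eventually_lt_atBot 0] with t ht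
  exact (Pf.hasDerivAt_log_der1_sideInverse ht).sub (Pk.hasDerivAt_log_der1_sideInverse ht)

end Converse

/-! ### Saddle pairs and profiles -/

section Conversion

variable {α : ℝ} {f k h ρ ρ' : ℝ → ℝ} {W : Set ℝ}

lemma nonneg_of_hasDerivWithinAt_Ioi {φ : ℝ → ℝ} {m a : ℝ} (hφ : HasDerivWithinAt φ m (Ioi a) a)
    (hle : ∀ᶠ x in 𝓝[>] a, φ a ≤ φ x) : 0 ≤ m := by
  refine ge_of_tendsto ((hasDerivWithinAt_iff_tendsto_slope' self_notMem_Ioi).1 hφ) ?_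
  filter_upwards [hle, self_mem_nhdsWithin] with x hx hax
  rw [slope_def_field]
  exact div_nonneg (sub_nonneg.2 hx) (sub_nonneg.2 hax.le)

lemma der2_zero_nonneg_of_der1_pos (hα : 0 < α) (hc : ContDiffOn ℝ 2 h (Icc (-α) α))
    (h0 : der1 α h 0 = 0) (hpos : ∀ x ∈ Ioc 0 α, 0 < der1 α h x) : 0 ≤ der2 α h 0 := by
  have hα' : -α < 0 := neg_neg_of_pos hα
  have hd : HasDerivWithinAt (der1 α h) (der2 α h 0) (Icc (-α) α) 0 :=
    ((hc.derivWithin (m := 1) (uniqueDiffOn_Icc (hα'.trans hα)) (by norm_num)).differentiableOn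
      one_ne_zero 0 ⟨hα'.le, hα.le⟩).hasDerivWithinAt
  refine nonneg_of_hasDerivWithinAt_Ioi (hd.hasDerivAt (Icc_mem_nhds hα' hα)).hasDerivWithinAt ?_
  filter_upwards [Ioc_mem_nhdsGT hα] with x hx
  exact h0.trans_le (hpos x hx).le

lemma IsSaddlePair.contDiffOn_fst {g : ℝ → ℝ} (hα : 0 < α) (H : IsSaddlePair α f g) :
    ContDiffOn ℝ 2 f (Icc (-α) α) := by
  have hcomp := H.contDiffOn.comp (contDiff_prodMk_left (0 : ℝ)).contDiffOn
    (fun x (hx : x ∈ Icc (-α) α) => mk_mem_prod hx ⟨neg_nonpos.2 hα.le, hα.le⟩)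
  exact hcomp.congr fun x _ => by simp only [Function.comp, sepPotential, H.g_zero, add_zero]

lemma IsSaddlePair.contDiffOn_snd {g : ℝ → ℝ} (hα : 0 < α) (H : IsSaddlePair α f g) :
    ContDiffOn ℝ 2 g (Icc (-α) α) := by
  have hcomp := H.contDiffOn.comp (contDiff_prodMk_right (0 : ℝ)).contDiffOn
    (fun x (hx : x ∈ Icc (-α) α) => mk_mem_prod ⟨neg_nonpos.2 hα.le, hα.le⟩ hx)
  exact hcomp.congr fun x _ => by simp only [Function.comp, sepPotential, H.f_zero, zero_add]

lemma IsSaddlePair.isProfile (hα : 0 < α) (H : IsSaddlePair α f (fun t => -k t)) :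
    IsProfile α f ∧ IsProfile α k := by
  have hcf := H.contDiffOn_fst hα
  have hck : ContDiffOn ℝ 2 k (Icc (-α) α) := by
    simpa only [neg_neg] using (H.contDiffOn_snd hα).neg
  have hright := H.right
  have hleft := H.left
  have hsaddle := H.saddle
  have hk0 := H.g_der_zero
  simp only [der1_neg, neg_neg_iff_pos, neg_pos] at hright hleft
  rw [der1_neg, neg_eq_zero] at hk0
  rw [der2_neg, mul_neg, neg_neg_iff_pos] at hsaddle
  have hf2 := der2_zero_nonneg_of_der1_pos hα hcf H.f_der_zero fun x hx => (hright x hx).1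
  have hk2 := der2_zero_nonneg_of_der1_pos hα hck hk0 fun x hx => (hright x hx).2
  exact ⟨⟨hcf, H.f_zero, H.f_der_zero, hf2.lt_of_ne' (left_ne_zero_of_mul hsaddle.ne'),
      fun x hx => (hright x hx).1, fun x hx => (hleft x hx).1⟩,
    ⟨hck, neg_eq_zero.1 H.g_zero, hk0, hk2.lt_of_ne' (right_ne_zero_of_mul hsaddle.ne'),
      fun x hx => (hright x hx).2, fun x hx => (hleft x hx).2⟩⟩

lemma IsProfile.isSaddlePair (Pf : IsProfile α f) (Pk : IsProfile α k) :
    IsSaddlePair α f (fun t => -k t) where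
  contDiffOn := (Pf.contDiffOn.comp contDiff_fst.contDiffOn fun _ hp => hp.1).add
    (Pk.contDiffOn.comp contDiff_snd.contDiffOn fun _ hp => hp.2).neg
  f_zero := Pf.zero
  g_zero := by rw [Pk.zero, neg_zero]
  f_der_zero := Pf.der_zero
  g_der_zero := by rw [der1_neg, Pk.der_zero, neg_zero]
  saddle := by
    rw [der2_neg, mul_neg, neg_neg_iff_pos]
    exact mul_pos Pf.der2_pos Pk.der2_pos
  right x hx := by
    rw [der1_neg, neg_neg_iff_pos]
    exact ⟨Pf.right x hx, Pk.right x hx⟩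
  left x hx := by
    rw [der1_neg, neg_pos]
    exact ⟨Pf.left x hx, Pk.left x hx⟩

lemma logBounded_neg_iff : LogBounded α (fun t => -h t) ↔ LogBounded α h := by
  have hneg : ∀ x, timePrimitive α (fun t => -h t) x - Real.log |x| / der2 α (fun t => -h t) 0
      = -(timePrimitive α h x - Real.log |x| / der2 α h 0) := fun x => by
    rw [timePrimitive_neg, der2_neg, div_neg]
    ring
  simp only [LogBounded, hneg, abs_neg]

lemma eqOn_der1_of_hasDerivAt (hα : 0 < α) (hρ : ∀ x ∈ Icc (-α) α, HasDerivAt h (ρ x) x) :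
    EqOn (der1 α h) ρ (Icc (-α) α) := fun x hx =>
  (hρ x hx).hasDerivWithinAt.derivWithin (uniqueDiffOn_Icc (by linarith) x hx)

lemma eqOn_der2_of_hasDerivAt (hα : 0 < α) (hρ : ∀ x ∈ Icc (-α) α, HasDerivAt h (ρ x) x)
    (hρ' : ∀ x ∈ Icc (-α) α, HasDerivAt ρ (ρ' x) x) : EqOn (der2 α h) ρ' (Icc (-α) α) :=
  fun x hx => by
    have heq := eqOn_der1_of_hasDerivAt hα hρ
    rw [der2, derivWithin_congr heq (heq hx)]
    exact eqOn_der1_of_hasDerivAt hα hρ' hx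

lemma contDiffOn_succ_of_hasDerivAt {n : ℕ} (hW : IsOpen W) (hρ : ∀ x ∈ W, HasDerivAt h (ρ x) x)
    (hc : ContDiffOn ℝ n ρ W) : ContDiffOn ℝ (n + 1) h W :=
  (contDiffOn_succ_iff_deriv_of_isOpen hW).2
    ⟨fun x hx => (hρ x hx).differentiableAt.differentiableWithinAt, by simp,
      hc.congr fun x hx => (hρ x hx).deriv⟩

lemma isProfile_of_hasDerivAt (hα : 0 < α) (hWo : IsOpen W) (hW : Icc (-α) α ⊆ W)
    (hρ : ∀ x ∈ W, HasDerivAt h (ρ x) x) (hρ' : ∀ x ∈ W, HasDerivAt ρ (ρ' x) x)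
    (hc : ContinuousOn ρ' W) (h0 : h 0 = 0) (hρ0 : ρ 0 = 0) (hρ0' : 0 < ρ' 0)
    (hr : ∀ x ∈ Ioc 0 α, 0 < ρ x) (hl : ∀ x ∈ Ico (-α) 0, ρ x < 0) : IsProfile α h := by
  have hzero : (0 : ℝ) ∈ Icc (-α) α := ⟨neg_nonpos.2 hα.le, hα.le⟩
  have heq := eqOn_der1_of_hasDerivAt hα fun x hx => hρ x (hW hx)
  have heq' := eqOn_der2_of_hasDerivAt hα (fun x hx => hρ x (hW hx)) fun x hx => hρ' x (hW hx)
  have hcρ : ContDiffOn ℝ 1 ρ W :=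
    contDiffOn_succ_of_hasDerivAt (n := 0) hWo hρ' (contDiffOn_zero.2 hc)
  exact {
    contDiffOn := (contDiffOn_succ_of_hasDerivAt (n := 1) hWo hρ hcρ).mono hW
    zero := h0
    der_zero := (heq hzero).trans hρ0
    der2_pos := hρ0'.trans_eq (heq' hzero).symm
    right := fun x hx => (hr x hx).trans_eq (heq ⟨hzero.1.trans hx.1.le, hx.2⟩).symm
    left := fun x hx => (heq ⟨hx.1, hx.2.le.trans hzero.2⟩).trans_lt (hl x hx) }

end Conversion

/-! ### A saddle which is not realizable -/

section Example

variable {α x : ℝ} {h : ℝ → ℝ}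

lemma IsProfile.timePrimitive_eq_sub_of_hasDerivAt (P : IsProfile α h) {Φ : ℝ → ℝ}
    (hΦ : ∀ t ∈ Ioc 0 α, HasDerivAt Φ (1 / der1 α h t) t) (hx : x ∈ Ioc 0 α) :
    timePrimitive α h x = Φ x - Φ α := by
  have hsub : uIcc α x ⊆ Ioc 0 α := by
    rw [uIcc_of_ge hx.2]
    exact fun t ht => ⟨hx.1.trans_le ht.1, ht.2⟩
  rw [timePrimitive, if_pos hx.1]
  refine intervalIntegral.integral_eq_sub_of_hasDerivAt (fun t ht => hΦ t (hsub ht)) ?_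
  exact ((P.continuousOn_one_div_der1 hx.1.ne').mono
    (hsub.trans_eq (if_pos hx.1).symm)).intervalIntegrable

lemma hasDerivAt_half_sq (x : ℝ) : HasDerivAt (fun t : ℝ => t ^ 2 / 2) x x :=
  ((hasDerivAt_pow 2 x).div_const 2).congr_deriv (by simp)

lemma isProfile_half_sq (hα : 0 < α) : IsProfile α (fun t => t ^ 2 / 2) :=
  isProfile_of_hasDerivAt hα isOpen_univ (subset_univ _) (fun x _ => hasDerivAt_half_sq x)
    (fun x _ => hasDerivAt_id x) continuousOn_const (by simp) rfl one_pos (fun _ hx => hx.1)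
    (fun _ hx => hx.2)

lemma der1_half_sq (hα : 0 < α) (hx : x ∈ Icc (-α) α) : der1 α (fun t => t ^ 2 / 2) x = x :=
  eqOn_der1_of_hasDerivAt hα (fun x _ => hasDerivAt_half_sq x) hx

lemma timePrimitive_half_sq (hα : 0 < α) (hx : x ∈ Ioc 0 α) :
    timePrimitive α (fun t => t ^ 2 / 2) x = Real.log x - Real.log α := by
  refine (isProfile_half_sq hα).timePrimitive_eq_sub_of_hasDerivAt (fun t ht => ?_) hx
  rw [der1_half_sq hα ⟨by linarith [ht.1], ht.2⟩, one_div]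
  exact Real.hasDerivAt_log ht.1.ne'

/-- `ℓ(x) = 2 + ln (α / |x|)`, whose slow divergence at `0` is the source of the counterexample. The
constant `2` makes `ℓ > 1` on a neighborhood of `[-α, α]`. -/
def slowLog (α x : ℝ) : ℝ := 2 + Real.log α - Real.log x

/-- The first derivative `x (1 - 1 / ℓ(x))` of `slowProfile`; the factor `x` makes it vanish at `0`,
whatever the value of `ℓ` there. -/
def slowDer (α x : ℝ) : ℝ := x * (1 - (slowLog α x)⁻¹)

/-- The second derivative `1 - 1 / ℓ - 1 / ℓ²` of `slowProfile`, extended by continuity at `0`. -/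
def slowDer2 (α x : ℝ) : ℝ :=
  if x = 0 then 1 else 1 - (slowLog α x)⁻¹ - (slowLog α x)⁻¹ ^ 2

/-- The function `f` of the counterexample, with `f'(x) = x (1 - 1 / ℓ(x))`: it satisfies
`f''(0) = 1`, but `F` differs from `ln` by the unbounded function `ln (ℓ - 1)`. -/
def slowProfile (α x : ℝ) : ℝ := ∫ t in (0 : ℝ)..x, slowDer α t

lemma one_lt_slowLog (hα : 0 < α) (hx : x ∈ Ioo (-(2 * α)) (2 * α)) (h0 : x ≠ 0) :
    1 < slowLog α x := by
  have hlog : Real.log x < Real.log 2 + Real.log α := by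
    rw [← Real.log_abs, ← Real.log_mul two_ne_zero hα.ne']
    exact Real.log_lt_log (abs_pos.2 h0) (abs_lt.2 hx)
  rw [slowLog]
  linarith [Real.log_two_lt_d9]

lemma tendsto_slowLog (α : ℝ) : Tendsto (slowLog α) (𝓝[≠] 0) atTop :=
  tendsto_atTop_add_const_left _ _ (tendsto_neg_atBot_atTop.comp Real.tendsto_log_nhdsNE_zero)

lemma tendsto_inv_slowLog (α : ℝ) : Tendsto (fun x => (slowLog α x)⁻¹) (𝓝[≠] 0) (𝓝 0) :=
  tendsto_inv_atTop_zero.comp (tendsto_slowLog α)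

lemma hasDerivAt_slowLog (α : ℝ) (h0 : x ≠ 0) : HasDerivAt (slowLog α) (-x⁻¹) x :=
  (Real.hasDerivAt_log h0).const_sub _

lemma hasDerivAt_slowDer (hα : 0 < α) (hx : x ∈ Ioo (-(2 * α)) (2 * α)) :
    HasDerivAt (slowDer α) (slowDer2 α x) x := by
  rcases eq_or_ne x 0 with rfl | h0
  · rw [hasDerivAt_iff_tendsto_slope, slowDer2, if_pos rfl]
    have hlim : Tendsto (fun x => 1 - (slowLog α x)⁻¹) (𝓝[≠] 0) (𝓝 1) := by
      simpa only [sub_zero] using (tendsto_inv_slowLog α).const_sub 1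
    refine hlim.congr' ?_
    filter_upwards [self_mem_nhdsWithin] with t ht
    rw [slope_def_field, slowDer, slowDer, zero_mul, sub_zero, sub_zero,
      mul_div_cancel_left₀ _ (mem_compl_singleton_iff.1 ht)]
  · have hℓ : slowLog α x ≠ 0 := (one_pos.trans (one_lt_slowLog hα hx h0)).ne'
    refine ((hasDerivAt_id x).mul
      (((hasDerivAt_slowLog α h0).inv hℓ).const_sub 1)).congr_deriv ?_
    rw [slowDer2, if_neg h0]
    simp only [id, Pi.inv_apply]
    field_simp
    ring

lemma continuousOn_slowDer2 (hα : 0 < α) : ContinuousOn (slowDer2 α) (Ioo (-(2 * α)) (2 * α)) := by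
  refine fun x hx => ContinuousAt.continuousWithinAt ?_
  have hne : ∀ t ≠ 0, 1 - (slowLog α t)⁻¹ - (slowLog α t)⁻¹ ^ 2 = slowDer2 α t :=
    fun t ht => (if_neg ht).symm
  rcases eq_or_ne x 0 with rfl | h0
  · rw [continuousAt_iff_punctured_nhds, slowDer2, if_pos rfl]
    have hlim : Tendsto (fun x => 1 - (slowLog α x)⁻¹ - (slowLog α x)⁻¹ ^ 2) (𝓝[≠] 0)
        (𝓝 (1 - 0 - 0 ^ 2)) :=
      ((tendsto_inv_slowLog α).const_sub 1).sub ((tendsto_inv_slowLog α).pow 2)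
    rw [zero_pow two_ne_zero, sub_zero, sub_zero] at hlim
    exact hlim.congr' (eventually_mem_nhdsWithin.mono hne)
  · have hinv : ContinuousAt (fun x => (slowLog α x)⁻¹) x :=
      (hasDerivAt_slowLog α h0).continuousAt.inv₀ (one_pos.trans (one_lt_slowLog hα hx h0)).ne'
    exact ((continuousAt_const.sub hinv).sub (hinv.pow 2)).congr
      ((eventually_ne_nhds h0).mono hne)

lemma hasDerivAt_slowProfile (hα : 0 < α) (hx : x ∈ Ioo (-(2 * α)) (2 * α)) :
    HasDerivAt (slowProfile α) (slowDer α x) x := by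
  have hc : ContinuousOn (slowDer α) (Ioo (-(2 * α)) (2 * α)) := fun t ht =>
    (hasDerivAt_slowDer hα ht).continuousAt.continuousWithinAt
  have h0 : (0 : ℝ) ∈ Ioo (-(2 * α)) (2 * α) := ⟨by linarith, by linarith⟩
  exact intervalIntegral.integral_hasDerivAt_right
    (hc.mono (ordConnected_Ioo.uIcc_subset h0 hx)).intervalIntegrable
    (hc.stronglyMeasurableAtFilter isOpen_Ioo x hx) (hasDerivAt_slowDer hα hx).continuousAt

lemma Icc_subset_Ioo_two_mul (hα : 0 < α) : Icc (-α) α ⊆ Ioo (-(2 * α)) (2 * α) :=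
  Icc_subset_Ioo (by linarith) (by linarith)

lemma inv_slowLog_lt_one (hα : 0 < α) (hx : x ∈ Icc (-α) α) (h0 : x ≠ 0) :
    (slowLog α x)⁻¹ < 1 :=
  inv_lt_one_of_one_lt₀ (one_lt_slowLog hα (Icc_subset_Ioo_two_mul hα hx) h0)

lemma isProfile_slowProfile (hα : 0 < α) : IsProfile α (slowProfile α) :=
  isProfile_of_hasDerivAt hα isOpen_Ioo (Icc_subset_Ioo_two_mul hα)
    (fun _ hx => hasDerivAt_slowProfile hα hx) (fun _ hx => hasDerivAt_slowDer hα hx)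
    (continuousOn_slowDer2 hα) intervalIntegral.integral_same (zero_mul _)
    (one_pos.trans_eq (if_pos rfl).symm)
    (fun _ hx => mul_pos hx.1
      (sub_pos.2 (inv_slowLog_lt_one hα ⟨by linarith [hx.1], hx.2⟩ hx.1.ne')))
    (fun _ hx => mul_neg_of_neg_of_pos hx.2
      (sub_pos.2 (inv_slowLog_lt_one hα ⟨hx.1, by linarith [hx.2]⟩ hx.2.ne)))

lemma der1_slowProfile (hα : 0 < α) (hx : x ∈ Icc (-α) α) :
    der1 α (slowProfile α) x = slowDer α x :=
  eqOn_der1_of_hasDerivAt hα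
    (fun _ hx => hasDerivAt_slowProfile hα (Icc_subset_Ioo_two_mul hα hx)) hx

lemma timePrimitive_slowProfile (hα : 0 < α) (hx : x ∈ Ioc 0 α) :
    timePrimitive α (slowProfile α) x = Real.log x - Real.log (slowLog α x - 1) - Real.log α := by
  have hαℓ : slowLog α α - 1 = 1 := by
    rw [slowLog]
    ring
  rw [(isProfile_slowProfile hα).timePrimitive_eq_sub_of_hasDerivAt
    (Φ := fun t => Real.log t - Real.log (slowLog α t - 1)) (fun t ht => ?_) hx, hαℓ,
    Real.log_one, sub_zero]
  have htK : t ∈ Icc (-α) α := ⟨by linarith [ht.1], ht.2⟩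
  have ht0 : t ≠ 0 := ht.1.ne'
  have hℓ := one_lt_slowLog hα (Icc_subset_Ioo_two_mul hα htK) ht0
  have hℓ0 : slowLog α t ≠ 0 := (one_pos.trans hℓ).ne'
  have hℓ1 : slowLog α t - 1 ≠ 0 := (sub_pos.2 hℓ).ne'
  have hslow : slowDer α t = t * (slowLog α t - 1) / slowLog α t := by
    rw [slowDer]
    field_simp
  refine ((Real.hasDerivAt_log ht0).sub
    (((hasDerivAt_slowLog α ht0).sub_const 1).log hℓ1)).congr_deriv ?_
  rw [der1_slowProfile hα htK, hslow]
  field_simp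
  ring

/- With `x = F⁻¹(t)`, the difference is `ln (1 - 1 / ℓ(x)) + ln (ℓ(x) - 1)`. -/
lemma tendsto_log_der1_slowProfile_sub_log_der1_half_sq (hα : 0 < α) :
    Tendsto (fun t => Real.log (der1 α (slowProfile α) (sideInverse α (slowProfile α) α t))
      - Real.log (der1 α (fun t => t ^ 2 / 2) (sideInverse α (fun t => t ^ 2 / 2) α t)))
      atBot atTop := by
  have Pf := isProfile_slowProfile hα
  have Pk := isProfile_half_sq hα
  have hmem : ∀ {h : ℝ → ℝ} {t : ℝ}, IsProfile α h → t ≤ 0 → sideInverse α h α t ∈ Ioc 0 α :=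
    fun P ht => ⟨pos_of_mul_pos_left (P.sideInverse_mul_pos hα.ne' ht) hα.le,
      (P.sideInverse_mem_Icc hα.ne' ht).2⟩
  have hx : Tendsto (sideInverse α (slowProfile α) α) atBot (𝓝[≠] 0) :=
    tendsto_nhdsWithin_iff.2 ⟨Pf.tendsto_sideInverse hα.ne',
      (eventually_le_atBot 0).mono fun t ht => (hmem Pf ht).1.ne'⟩
  have hlim : Tendsto (fun x => Real.log (1 - (slowLog α x)⁻¹) + Real.log (slowLog α x - 1))
      (𝓝[≠] 0) atTop := by
    have hone : Tendsto (fun x => 1 - (slowLog α x)⁻¹) (𝓝[≠] 0) (𝓝 1) := by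
      simpa only [sub_zero] using (tendsto_inv_slowLog α).const_sub 1
    exact (hone.log one_ne_zero).add_atTop
      (Real.tendsto_log_atTop.comp (tendsto_atTop_add_const_right _ (-1) (tendsto_slowLog α)))
  refine (hlim.comp hx).congr' ?_
  filter_upwards [eventually_le_atBot 0] with t ht
  obtain ⟨hx0, hxα⟩ := hmem Pf ht
  obtain ⟨hy0, hyα⟩ := hmem Pk ht
  have hxK : sideInverse α (slowProfile α) α t ∈ Icc (-α) α := ⟨by linarith, hxα⟩
  have htf := timePrimitive_slowProfile hα ⟨hx0, hxα⟩
  have htk := timePrimitive_half_sq hα ⟨hy0, hyα⟩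
  rw [Pf.timePrimitive_sideInverse hα.ne' ht] at htf
  rw [Pk.timePrimitive_sideInverse hα.ne' ht] at htk
  have hpos := sub_pos.2 (inv_slowLog_lt_one hα hxK hx0.ne')
  rw [Function.comp, der1_slowProfile hα hxK, der1_half_sq hα ⟨by linarith, hyα⟩, slowDer,
    Real.log_mul hx0.ne' hpos.ne']
  linarith

lemma planeLaplacian_slowProfile (hα : 0 < α) :
    planeLaplacian (sepPotential (slowProfile α) fun t => -(t ^ 2 / 2)) (0, 0) = 0 := by
  have hzero : (0 : ℝ) ∈ Icc (-α) α := ⟨neg_nonpos.2 hα.le, hα.le⟩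
  have hf : der2 α (slowProfile α) 0 = slowDer2 α 0 :=
    eqOn_der2_of_hasDerivAt hα
      (fun _ hx => hasDerivAt_slowProfile hα (Icc_subset_Ioo_two_mul hα hx))
      (fun _ hx => hasDerivAt_slowDer hα (Icc_subset_Ioo_two_mul hα hx)) hzero
  have hk : der2 α (fun t => t ^ 2 / 2) 0 = 1 :=
    eqOn_der2_of_hasDerivAt hα (fun x _ => hasDerivAt_half_sq x) (fun x _ => hasDerivAt_id x) hzero
  rw [planeLaplacian_sepPotential (isProfile_slowProfile hα) (isProfile_half_sq hα)
    (mem_interior_squareK.2 ⟨⟨neg_neg_of_pos hα, hα⟩, ⟨neg_neg_of_pos hα, hα⟩⟩), hf, hk, slowDer2,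
    if_pos rfl, sub_self]

end Example

end

theorem mainTheorem4 (α : ℝ) (hα : 0 < α) :
    (∀ f g : ℝ → ℝ, IsSaddlePair α f g →
      -- the function `w` is well defined and of class `C¹` off the axes
      (IsOpen (regionQ α f g) ∧ (0, 0) ∈ regionQ α f g ∧
        ∃ τ w : ℝ × ℝ → ℝ,
          IsHittingIntegral (sepPotential f g) (interior (squareK α))
            (regionQ α f g \ (stableCurve α ∪ unstableCurve α)) τ w ∧
          ContDiffOn ℝ 1 w (regionQ α f g \ (stableCurve α ∪ unstableCurve α))) ∧
      -- i)
      ((∃ σ : ℝ × ℝ → ℝ,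
          IsRealizableWith (sepPotential f g) (regionQ α f g) σ ∧
          MemLinfLoc (regionQ α f g) σ ∧ MemLinfLoc (regionQ α f g) (fun p => (σ p)⁻¹) ∧
          ContDiffOn ℝ 1 σ (regionQ α f g \ (stableCurve α ∪ unstableCurve α)) ∧
          ContDiffOn ℝ 1 (fun p => (σ p)⁻¹)
            (regionQ α f g \ (stableCurve α ∪ unstableCurve α))) →
        planeLaplacian (sepPotential f g) (0, 0) = 0) ∧
      -- ii)
      (planeLaplacian (sepPotential f g) (0, 0) = 0 → LogBounded α f → LogBounded α g →
        ∃ σ : ℝ × ℝ → ℝ,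
          IsRealizableWith (sepPotential f g) (regionQ α f g) σ ∧
          MemLinfLoc (regionQ α f g) σ ∧ MemLinfLoc (regionQ α f g) (fun p => (σ p)⁻¹) ∧
          ContDiffOn ℝ 1 σ (regionQ α f g \ (stableCurve α ∪ unstableCurve α)) ∧
          ContDiffOn ℝ 1 (fun p => (σ p)⁻¹)
            (regionQ α f g \ (stableCurve α ∪ unstableCurve α)))) ∧
    -- iii)
    (∃ f g : ℝ → ℝ, IsSaddlePair α f g ∧ planeLaplacian (sepPotential f g) (0, 0) = 0 ∧
      ∀ V : Set (ℝ × ℝ), IsOpen V → (0, 0) ∈ V → V ⊆ squareK α →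
        ¬ ∃ σ : ℝ × ℝ → ℝ,
          IsRealizableWith (sepPotential f g) V σ ∧
          MemLinf V σ ∧ MemLinf V (fun p => (σ p)⁻¹) ∧
          ContDiffOn ℝ 1 σ (V \ (stableCurve α ∪ unstableCurve α)) ∧
          ContDiffOn ℝ 1 (fun p => (σ p)⁻¹) (V \ (stableCurve α ∪ unstableCurve α))) := by
  refine ⟨fun f g H => ?_, slowProfile α, fun t => -(t ^ 2 / 2),
    (isProfile_slowProfile hα).isSaddlePair (isProfile_half_sq hα),
    planeLaplacian_slowProfile hα, ?_⟩
  · obtain ⟨k, rfl⟩ : ∃ k : ℝ → ℝ, g = fun t => -k t := ⟨fun t => -g t, by simp⟩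
    obtain ⟨Pf, Pk⟩ := H.isProfile hα
    have hQ0 := zero_mem_regionQ hα f fun t => -k t
    have hQK := regionQ_subset_interior α f fun t => -k t
    rw [planeLaplacian_sepPotential Pf Pk (hQK hQ0), sub_eq_zero]
    refine ⟨⟨isOpen_regionQ Pf Pk, hQ0, hitTime α f k, hitWeight α f k,
      isHittingIntegral_hitTime Pf Pk, contDiffOn_hitWeight Pf Pk⟩, ?_, fun h0 hf hg => ?_⟩
    · rintro ⟨σ, hreal, h1, h2, hσ, -⟩
      obtain ⟨C, hC⟩ := exists_eventually_abs_log_der1_sub_le Pf Pk (isOpen_regionQ Pf Pk) hQ0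
        (hQK.trans interior_subset) hreal h1 h2 hσ
      exact der2_zero_eq_of_eventually_abs_log_der1_sub_le Pf Pk hC
    · obtain ⟨C, hC⟩ := exists_abs_hitWeight_le Pf Pk hf (logBounded_neg_iff.1 hg) h0
      exact exists_isRealizableWith Pf Pk hC
  · rintro V hV h0 hVK ⟨σ, hreal, h1, h2, hσ, -⟩
    obtain ⟨C, hC⟩ := exists_eventually_abs_log_der1_sub_le (isProfile_slowProfile hα)
      (isProfile_half_sq hα) hV h0 hVK hreal
      (fun C _ hC => h1.mono_measure (Measure.restrict_mono hC le_rfl))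
      (fun C _ hC => h2.mono_measure (Measure.restrict_mono hC le_rfl)) hσ
    obtain ⟨t, ht, htC⟩ := (hC.and ((tendsto_log_der1_slowProfile_sub_log_der1_half_sq
      hα).eventually_gt_atTop C)).exists
    exact htC.not_ge ((le_abs_self _).trans ht)
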